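/- Let $S$ be a finite nonempty set and let $\mu:S\times S\to\mathbb R_{\ge 0}$ be a directed distance, i.e. $\mu(s,s)=0$ for all $s\in S$ (no triangle inequality and no symmetry is assumed). Let $S^c=\{s^c\}$ and $S^r=\{s^r\}$ be two disjoint copies of $S$, put $S^{cr}=S^c\cup S^r$, and for $p\in\mathbb R^{S^{cr}}$ let $p^c,p^r$ be the restrictions of $p$ to $S^c,S^r$. For $X\subseteq S$ write $X^c,X^r$ for its copies. Define $$D_\infty(p,q)=\max\Big\{\max_{s\in S}\,(q(s^c)-p(s^c))_+,\ \max_{s\in S}\,(p(s^r)-q(s^r))_+\Big\},$$ $$P_\mu=\{p\in\mathbb R^{S^{cr}} : p(s^c)+p(t^r)\ge\mu(s,t)\ \ (s,t\in S)\},\qquad Q_\mu=\{\text{minimal elements of }P_\mu\text{ in the coordinatewise order}\}.$$ For a set $R$ of points, $R^+$ is the set of its nonnegative points, and for $s\in S$ the terminal region is $R_s=\{p\in R: p(s^c)+p(s^r)=0\}$. For vectors, $<$ means strict inequality in every coordinate; $R$ is balanced if there are no $p,q\in R$ with $p^c<q^c$ or $p^r<q^r$. For $p\in Q_\mu$ let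 $K(p)$ be the bipartite graph on $S^{cr}$ with edges $s^ct^r$ for $p(s^c)+p(t^r)=\mu(s,t)$, and let $N_p(U)$ be the set of nodes outside $U$ adjacent to a node of $U$. Let $\mathcal S_0$ be the family of $X\subseteq S$ with $\mu=0$ on $X\times X$. For $X\in\mathcal S_0$ let $Q_{\mu,X}$ be the set of $p\in Q_\mu$ such that, for every $s\in S$, $s^cs^r$ is an edge of $K(p)$ if and only if $s\in X$. A point $p\in Q_{\mu,X}$ is a fat relative to $X$ if $N_p(S^c\setminus X^c)\subseteq S^r\setminus X^r$ or $N_p(S^r\setminus X^r)\subseteq S^c\setminus X^c$; the degenerate set $Q_{\mu,X}^{deg}$ consists of the $p\in Q_{\mu,X}$ for which one of these two inclusions is an equality. A proper fat is a fat (relative to some $X\in\mathcal S_0$) that lies in no degenerate set. Let $Q_\mu^{slim}$ be $Q_\mu$ with all proper fats removed. On $Q_\mu^{slim}$ let $p\sim q$ if $p-q\in\mathbb R(\mathbf 1,-\mathbf 1)$, or if for some $X\in\mathcal S_0$ both $p,q\in Q_{\mu,X}^{deg}$ and $p-q\in\mathbb R(\mathbf 1,-\mathbf 1)+\mathbb R(\mathbf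 1_{X^c},-\mathbf 1_{X^r})$; this is an equivalence relation. A section is a subset of $Q_\mu^{slim}$ that the projection maps bijectively onto $Q_\mu^{slim}/\!\sim$. A slimmed section in $(Q_\mu^{slim})^+$ is a balanced section $R\subseteq(Q_\mu^{slim})^+$ such that for each $X\in\mathcal S_0$ with $X\neq S$ there are no $p,q\in R\cap(Q_{\mu,X}^{deg})^+$ with $p(s^c)<q(s^c)$ for all $s\in S\setminus X$, or with $p(s^r)<q(s^r)$ for all $s\in S\setminus X$. A slimmed section (in $Q_\mu^{slim}$) is a balanced section $R$ such that $R/(\mathbf 1,-\mathbf 1)\mathbb R=R'/(\mathbf 1,-\mathbf 1)\mathbb R$ for some slimmed section $R'$ in $(Q_\mu^{slim})^+$. A set $R$ is geodesic if for any two distinct $p,q\in R$ there is an injective continuous map $\varrho:[0,1]\to R$ with $\varrho(0)=p$, $\varrho(1)=q$ whose length from $p$ to $q$, namely the supremum of $\sum_{i=0}^{n-1}D_\infty(\varrho(t_i),\varrho(t_{i+1}))$ over all $n>0$ and $0=t_0<t_1<\dots<t_n=1$, equals $D_\infty(p,q)$. **Statement.** Let $R\subseteq Q_\mu$ be a slimmed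 section. 1. $R$ is contractible (in the Euclidean topology) and geodesic, and so is $R_s$ for every $s\in S$. 2. If $R\subseteq Q_\mu^+$, then for all $s,t\in S$, $$D_\infty(R_s,R_t):=\inf\{D_\infty(p,q): p\in R_s,\ q\in R_t\}=\mu(s,t).$$ -/

import Mathlib

namespace SlimTropical

/-- Points of `ℝ^{S^c ∪ S^r}`; `Sum.inl s` is the element `s^c` and `Sum.inr s` is `s^r`. -/
abbrev Pt (S : Type*) := S ⊕ S → ℝ

/-- A directed distance on `S`: nonnegative, with zero diagonal. -/
structure IsDirectedDistance {S : Type*} (μ : S → S → ℝ) : Prop where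
  nonneg : ∀ s t, 0 ≤ μ s t
  diag : ∀ s, μ s s = 0

/-- `D_∞^+(p, q) = ‖(q - p)_+‖_∞` on `ℝ^X`. -/
noncomputable def dPlus {X : Type*} [Fintype X] (p q : X → ℝ) : ℝ :=
  ‖fun x => max (q x - p x) 0‖

/-- `D_∞(p, q) = max (D_∞^+(p^c, q^c)) (D_∞^+(q^r, p^r))`. -/
noncomputable def dInf {S : Type*} [Fintype S] (p q : Pt S) : ℝ :=
  max (dPlus (fun s => p (Sum.inl s)) (fun s => q (Sum.inl s)))
    (dPlus (fun s => q (Sum.inr s)) (fun s => p (Sum.inr s)))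

section Polyhedra

variable {S : Type*}

/-- The polyhedron `P_μ`. -/
def P (μ : S → S → ℝ) : Set (Pt S) :=
  {p | ∀ s t, μ s t ≤ p (Sum.inl s) + p (Sum.inr t)}

/-- `Q_μ`, the set of minimal elements of `P_μ` for the coordinatewise order. -/
def Q (μ : S → S → ℝ) : Set (Pt S) :=
  {p | Minimal (fun q => q ∈ P μ) p}

/-- `R^+`, the set of nonnegative points of `R`. -/
def nonnegPart (R : Set (Pt S)) : Set (Pt S) := {p | p ∈ R ∧ ∀ u, 0 ≤ p u}

/-- The terminal region `R_s` of `R`. -/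
def region (R : Set (Pt S)) (s : S) : Set (Pt S) :=
  {p | p ∈ R ∧ p (Sum.inl s) + p (Sum.inr s) = 0}

/-- No two points `p, q` of `R` have `p^c < q^c` or `p^r < q^r`, where `<` means strictly smaller
in every coordinate. -/
def IsBalanced (R : Set (Pt S)) : Prop :=
  ¬ ∃ p ∈ R, ∃ q ∈ R, (∀ s, p (Sum.inl s) < q (Sum.inl s)) ∨ (∀ s, p (Sum.inr s) < q (Sum.inr s))

/-- The vector `(𝟙_{X^c}, -𝟙_{X^r})`. -/
noncomputable def dirVec (X : Set S) : Pt S :=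
  Sum.elim (X.indicator (fun _ => (1 : ℝ))) (fun s => -X.indicator (fun _ => (1 : ℝ)) s)

/-- The line `(𝟙, -𝟙)ℝ`. -/
noncomputable def diagLine (S : Type*) : Submodule ℝ (Pt S) :=
  Submodule.span ℝ {dirVec Set.univ}

/-- The bipartite graph `K(p)` on `S^c ∪ S^r`. -/
def K (μ : S → S → ℝ) (p : Pt S) : SimpleGraph (S ⊕ S) :=
  SimpleGraph.fromRel fun u v =>
    ∃ s t, u = Sum.inl s ∧ v = Sum.inr t ∧ p (Sum.inl s) + p (Sum.inr t) = μ s t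

/-- `N_p(U)`: the nodes outside `U` adjacent in `K(p)` to a node of `U`. -/
def N (μ : S → S → ℝ) (p : Pt S) (U : Set (S ⊕ S)) : Set (S ⊕ S) :=
  {v | v ∉ U ∧ ∃ u ∈ U, (K μ p).Adj u v}

/-- `X ∈ 𝓢₀`: `μ` vanishes on `X × X`. -/
def IsNull (μ : S → S → ℝ) (X : Set S) : Prop := ∀ s ∈ X, ∀ t ∈ X, μ s t = 0

/-- `Q_{μ,X}`. -/
def QX (μ : S → S → ℝ) (X : Set S) : Set (Pt S) :=
  {p | p ∈ Q μ ∧ ∀ s, (K μ p).Adj (Sum.inl s) (Sum.inr s) ↔ s ∈ X}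

/-- `p` is a fat relative to `X`; here `Sum.inl '' Xᶜ` is `S^c \ X^c`, and likewise for `inr`. -/
def IsFatRel (μ : S → S → ℝ) (X : Set S) (p : Pt S) : Prop :=
  p ∈ QX μ X ∧
    (N μ p (Sum.inl '' Xᶜ) ⊆ Sum.inr '' Xᶜ ∨ N μ p (Sum.inr '' Xᶜ) ⊆ Sum.inl '' Xᶜ)

/-- The degenerate set `Q_{μ,X}^{deg}`. -/
def Qdeg (μ : S → S → ℝ) (X : Set S) : Set (Pt S) :=
  {p | p ∈ QX μ X ∧
    (N μ p (Sum.inl '' Xᶜ) = Sum.inr '' Xᶜ ∨ N μ p (Sum.inr '' Xᶜ) = Sum.inl '' Xᶜ)}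

/-- A proper fat: a fat (relative to some `X ∈ 𝓢₀`) lying in no degenerate set. -/
def IsProperFat (μ : S → S → ℝ) (p : Pt S) : Prop :=
  (∃ X, IsNull μ X ∧ IsFatRel μ X p) ∧ ¬ ∃ X, IsNull μ X ∧ p ∈ Qdeg μ X

/-- `Q_μ^{slim}`. -/
def Qslim (μ : S → S → ℝ) : Set (Pt S) := {p | p ∈ Q μ ∧ ¬ IsProperFat μ p}

/-- The relation `∼`. -/
def SlimRel (μ : S → S → ℝ) (p q : Pt S) : Prop :=
  p - q ∈ diagLine S ∨
    ∃ X, IsNull μ X ∧ p ∈ Qdeg μ X ∧ q ∈ Qdeg μ X ∧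
      p - q ∈ diagLine S ⊔ Submodule.span ℝ {dirVec X}

theorem mem_diagLine {v : Pt S} :
    v ∈ diagLine S ↔ ∃ a : ℝ, (∀ s, v (Sum.inl s) = a) ∧ ∀ s, v (Sum.inr s) = -a := by
  unfold diagLine
  rw [Submodule.mem_span_singleton]
  constructor
  · rintro ⟨a, rfl⟩
    exact ⟨a, fun s => by simp [dirVec], fun s => by simp [dirVec]⟩
  · rintro ⟨a, h1, h2⟩
    refine ⟨a, ?_⟩
    ext u
    rcases u with s | s
    · simp [dirVec, h1]
    · simp [dirVec, h2]

theorem sum_eq_of_sub_mem {p q : Pt S} (h : p - q ∈ diagLine S) (s t : S) :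
    p (Sum.inl s) + p (Sum.inr t) = q (Sum.inl s) + q (Sum.inr t) := by
  obtain ⟨a, h1, h2⟩ := mem_diagLine.1 h
  have e1 := h1 s
  have e2 := h2 t
  simp only [Pi.sub_apply] at e1 e2
  linarith

theorem P_of_sub_mem {μ : S → S → ℝ} {p q : Pt S} (h : p - q ∈ diagLine S) (hq : q ∈ P μ) :
    p ∈ P μ := fun s t => by
  rw [sum_eq_of_sub_mem h]
  exact hq s t

theorem Q_of_sub_mem {μ : S → S → ℝ} {p q : Pt S} (h : p - q ∈ diagLine S) (hq : q ∈ Q μ) :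
    p ∈ Q μ := by
  refine ⟨P_of_sub_mem h hq.1, fun y hy hle => ?_⟩
  have h1 : (y - (p - q)) - y ∈ diagLine S := by
    have e : (y - (p - q)) - y = -(p - q) := by abel
    rw [e]
    exact neg_mem h
  have h2 : y - (p - q) ≤ q := fun u => by
    have := hle u
    simp only [Pi.sub_apply]
    linarith
  intro u
  have := hq.2 (P_of_sub_mem h1 hy) h2 u
  simp only [Pi.sub_apply] at this
  linarith

theorem K_of_sub_mem {μ : S → S → ℝ} {p q : Pt S} (h : p - q ∈ diagLine S) : K μ p = K μ q := by
  unfold K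
  simp only [sum_eq_of_sub_mem h]

theorem Qdeg_of_sub_mem {μ : S → S → ℝ} {X : Set S} {p q : Pt S} (h : p - q ∈ diagLine S)
    (hq : q ∈ Qdeg μ X) : p ∈ Qdeg μ X := by
  simp only [Qdeg, QX, N, Set.mem_ofPred_eq, K_of_sub_mem h] at hq ⊢
  exact ⟨⟨Q_of_sub_mem h hq.1.1, hq.1.2⟩, hq.2⟩

theorem slimRel_equivalence (μ : S → S → ℝ) : Equivalence (SlimRel μ) where
  refl p := Or.inl (by simp)
  symm := by
    rintro p q (h | ⟨X, hX, hp, hq, h⟩)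
    · exact Or.inl (by simpa using neg_mem h)
    · exact Or.inr ⟨X, hX, hq, hp, by simpa using neg_mem h⟩
  trans := by
    rintro p q r (h | ⟨X, hX, hp, hq, h⟩) (h' | ⟨Y, hY, hq', hr, h'⟩)
    · exact Or.inl (by simpa using add_mem h h')
    · refine Or.inr ⟨Y, hY, Qdeg_of_sub_mem h hq', hr, ?_⟩
      simpa using add_mem (Submodule.mem_sup_left h) h'
    · refine Or.inr ⟨X, hX, hp, Qdeg_of_sub_mem (by simpa using neg_mem h') hq, ?_⟩
      simpa using add_mem h (Submodule.mem_sup_left h')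
    · have e : X = Y := by
        ext s
        rw [← hq.1.2 s, ← hq'.1.2 s]
      subst e
      exact Or.inr ⟨X, hX, hp, hr, by simpa using add_mem h h'⟩

/-- The relation `∼` on `Q_μ^{slim}`. -/
def slimSetoid (μ : S → S → ℝ) : Setoid (Qslim μ) where
  r p q := SlimRel μ p q
  iseqv := ⟨fun p => (slimRel_equivalence μ).refl p, fun h => (slimRel_equivalence μ).symm h,
    fun h h' => (slimRel_equivalence μ).trans h h'⟩

/-- The slimmed tropical polytope `Q_μ^{slim}/∼`. -/
abbrev SlimPolytope (μ : S → S → ℝ) := Quotient (slimSetoid μ)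

/-- A section: a subset of `Q_μ^{slim}` projected bijectively onto `Q_μ^{slim}/∼`. -/
structure IsSection (μ : S → S → ℝ) (R : Set (Pt S)) : Prop where
  subset : R ⊆ Qslim μ
  bijective : Function.Bijective
    (fun r : R => (Quotient.mk (slimSetoid μ) ⟨r.1, subset r.2⟩ : SlimPolytope μ))

/-- A slimmed section in `(Q_μ^{slim})^+`. For `X = S` there is no coordinate to compare, and the
last condition says nothing. -/
structure IsSlimmedSectionPos (μ : S → S → ℝ) (R : Set (Pt S)) : Prop where
  isSection : IsSection μ R
  subset_nonneg : R ⊆ nonnegPart (Qslim μ)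
  balanced : IsBalanced R
  deg_balanced : ∀ X, IsNull μ X → X ≠ Set.univ →
    ¬ ∃ p ∈ R ∩ nonnegPart (Qdeg μ X), ∃ q ∈ R ∩ nonnegPart (Qdeg μ X),
      (∀ s ∉ X, p (Sum.inl s) < q (Sum.inl s)) ∨ (∀ s ∉ X, p (Sum.inr s) < q (Sum.inr s))

/-- A slimmed section in `Q_μ^{slim}`. -/
structure IsSlimmedSection (μ : S → S → ℝ) (R : Set (Pt S)) : Prop where
  isSection : IsSection μ R
  balanced : IsBalanced R
  exists_pos : ∃ R', IsSlimmedSectionPos μ R' ∧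
    (diagLine S).mkQ '' R = (diagLine S).mkQ '' R'

end Polyhedra

/-- `ℓ` is the length, from `ϱ(0)` to `ϱ(1)`, of the path `ϱ` with respect to `D_∞`. -/
def HasLength {S : Type*} [Fintype S] (ϱ : unitInterval → Pt S) (ℓ : ℝ) : Prop :=
  IsLUB {L : ℝ | ∃ n : ℕ, 0 < n ∧ ∃ t : Fin (n + 1) → unitInterval,
    StrictMono t ∧ t 0 = 0 ∧ t (Fin.last n) = 1 ∧
      L = ∑ i : Fin n, dInf (ϱ (t i.castSucc)) (ϱ (t i.succ))} ℓ

/-- Any two distinct points `p, q` of `R` are joined by an injective path in `R` whose length from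
`p` to `q` is `D_∞(p, q)`. (For `p = q` the one-point path has length `0`.) -/
def IsGeodesic {S : Type*} [Fintype S] (R : Set (Pt S)) : Prop :=
  ∀ p ∈ R, ∀ q ∈ R, p ≠ q → ∃ ϱ : unitInterval → Pt S,
    Continuous ϱ ∧ Function.Injective ϱ ∧ (∀ x, ϱ x ∈ R) ∧ ϱ 0 = p ∧ ϱ 1 = q ∧
      HasLength ϱ (dInf p q)

end SlimTropical

/-!
The maps that matter are nonexpansive for the metric `D_∞(p, q) + D_∞(q, p)`. The convex set `P_μ^+`
has such a retraction onto the set `T_μ` of its minimal points, the tropical tight span. Let `R` be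
a slimmed section in `(Q_μ^{slim})^+`. A point of `T_μ` off `R` lies on one of two sides of `R`,
and a flow on `T_μ` moves it along `-(𝟙, -𝟙)` (respectively `(𝟙, -𝟙)`), holding the coordinates that
have reached `0`, until it lands on `R`. The slimming conditions say exactly that the two sides are
disjoint and relatively open and that a point moving downwards cannot jump over `R`; hence landing
is again a nonexpansive retraction, and it never leaves a terminal region. A general slimmed section
is obtained from such an `R` by translating each point along `(𝟙, -𝟙)`, and between balanced sets
such a translation is an isometry.

A nonexpansive retract of a convex set is contractible. It is geodesic because the retraction
cannot lengthen a segment in either direction, so equality holds in all triangle inequalities along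
its image. For the distance between terminal regions, `D_∞(p, q) ≥ μ(s, t)` on `P_μ^+`, and the
retraction carries a pair of points that is extremal in both directions into `R`.
-/

namespace SlimTropical

open Sum (inl inr)
open Set Filter Topology AffineMap

section Distance

theorem dPlus_nonneg {X : Type*} [Fintype X] (x y : X → ℝ) : 0 ≤ dPlus x y := norm_nonneg _

theorem dPlus_le_iff {X : Type*} [Fintype X] {x y : X → ℝ} {a : ℝ} :
    dPlus x y ≤ a ↔ 0 ≤ a ∧ ∀ s, y s ≤ x s + a := by
  constructor
  · intro h
    have ha : 0 ≤ a := (dPlus_nonneg x y).trans h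
    refine ⟨ha, fun s => ?_⟩
    have hs := (le_abs_self _).trans ((pi_norm_le_iff_of_nonneg ha).1 h s)
    linarith [le_max_left (y s - x s) 0]
  · rintro ⟨ha, h⟩
    refine (pi_norm_le_iff_of_nonneg ha).2 fun s => ?_
    rw [Real.norm_of_nonneg (le_max_right _ _)]
    exact max_le (by linarith [h s]) ha

variable {S : Type*} [Fintype S]

theorem dInf_le_iff {p q : Pt S} {a : ℝ} : dInf p q ≤ a ↔
    0 ≤ a ∧ (∀ s, q (inl s) ≤ p (inl s) + a) ∧ ∀ s, p (inr s) ≤ q (inr s) + a := by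
  unfold dInf
  rw [max_le_iff, dPlus_le_iff, dPlus_le_iff]
  tauto

theorem dInf_nonneg (p q : Pt S) : 0 ≤ dInf p q := (dInf_le_iff.1 le_rfl).1

theorem inl_le_add_dInf (p q : Pt S) (s : S) : q (inl s) ≤ p (inl s) + dInf p q :=
  (dInf_le_iff.1 le_rfl).2.1 s

theorem inr_le_add_dInf (p q : Pt S) (s : S) : p (inr s) ≤ q (inr s) + dInf p q :=
  (dInf_le_iff.1 le_rfl).2.2 s

@[simp]
theorem dInf_self (p : Pt S) : dInf p p = 0 :=
  le_antisymm (dInf_le_iff.2 ⟨le_rfl, by simp, by simp⟩) (dInf_nonneg _ _)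

theorem dInf_triangle (p q r : Pt S) : dInf p r ≤ dInf p q + dInf q r :=
  dInf_le_iff.2 ⟨add_nonneg (dInf_nonneg _ _) (dInf_nonneg _ _),
    fun s => by linarith [inl_le_add_dInf p q s, inl_le_add_dInf q r s],
    fun s => by linarith [inr_le_add_dInf p q s, inr_le_add_dInf q r s]⟩

theorem dInf_le_dist (p q : Pt S) : dInf p q ≤ dist p q := by
  have h (u : S ⊕ S) := abs_le.1 (dist_le_pi_dist p q u)
  exact dInf_le_iff.2 ⟨dist_nonneg, fun s => by linarith [h (inl s)],
    fun s => by linarith [h (inr s)]⟩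

theorem dInf_lineMap_le (p q : Pt S) {a b : ℝ} (hab : a ≤ b) :
    dInf (lineMap p q a) (lineMap p q b) ≤ (b - a) * dInf p q := by
  have hba := sub_nonneg.2 hab
  refine dInf_le_iff.2 ⟨mul_nonneg hba (dInf_nonneg _ _), fun s => ?_, fun s => ?_⟩
  · simp only [pi_lineMap_apply, lineMap_apply_module', smul_eq_mul]
    linarith [mul_le_mul_of_nonneg_left (inl_le_add_dInf p q s) hba]
  · simp only [pi_lineMap_apply, lineMap_apply_module', smul_eq_mul]
    linarith [mul_le_mul_of_nonneg_left (inr_le_add_dInf p q s) hba]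

/-- The symmetrization `D_∞(p, q) + D_∞(q, p)` of `D_∞`, a metric equivalent to the sup metric. -/
noncomputable def dSym (p q : Pt S) : ℝ := dInf p q + dInf q p

theorem dSym_comm (p q : Pt S) : dSym p q = dSym q p := add_comm _ _

theorem dist_le_dSym (p q : Pt S) : dist p q ≤ dSym p q := by
  have h₁ := dInf_nonneg p q
  have h₂ := dInf_nonneg q p
  refine (dist_pi_le_iff (add_nonneg h₁ h₂)).2 ?_
  rintro (s | s) <;> rw [Real.dist_eq, abs_le]
  · constructor <;> linarith [inl_le_add_dInf p q s, inl_le_add_dInf q p s]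
  · constructor <;> linarith [inr_le_add_dInf p q s, inr_le_add_dInf q p s]

theorem dSym_le_two_mul_dist (p q : Pt S) : dSym p q ≤ 2 * dist p q := by
  have h := dInf_le_dist q p
  rw [dist_comm] at h
  unfold dSym
  linarith [dInf_le_dist p q]

theorem eq_of_dSym_le_zero {p q : Pt S} (h : dSym p q ≤ 0) : p = q :=
  dist_le_zero.1 ((dist_le_dSym p q).trans h)

theorem dSym_lineMap_le (p q : Pt S) (a b : ℝ) :
    dSym (lineMap p q a) (lineMap p q b) ≤ |b - a| * dSym p q := by
  wlog hab : a ≤ b generalizing a b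
  · rw [dSym_comm, abs_sub_comm]
    exact this b a (le_of_not_ge hab)
  have hpq := dInf_lineMap_le p q hab
  have hqp := dInf_lineMap_le q p (sub_le_sub_left hab 1)
  rw [lineMap_apply_one_sub, lineMap_apply_one_sub] at hqp
  rw [abs_of_nonneg (sub_nonneg.2 hab), dSym, dSym]
  linarith

end Distance

section Paths

variable {S : Type*} [Fintype S]

theorem hasLength_of_additive {γ : unitInterval → Pt S}
    (hγ : ∀ a b, a ≤ b → dInf (γ 0) (γ a) + dInf (γ a) (γ b) = dInf (γ 0) (γ b)) :
    HasLength γ (dInf (γ 0) (γ 1)) := by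
  have hsum (n : ℕ) (t : Fin (n + 1) → unitInterval) (ht : StrictMono t) (h₀ : t 0 = 0)
      (h₁ : t (Fin.last n) = 1) :
      ∑ i : Fin n, dInf (γ (t i.castSucc)) (γ (t i.succ)) = dInf (γ 0) (γ 1) := by
    have hstep (i : Fin n) : dInf (γ (t i.castSucc)) (γ (t i.succ)) =
        dInf (γ 0) (γ (t i.succ)) - dInf (γ 0) (γ (t i.castSucc)) :=
      eq_sub_of_add_eq' (hγ _ _ (ht (Fin.castSucc_lt_succ (i := i))).le)
    have hsucc := Fin.sum_univ_succ fun i => dInf (γ 0) (γ (t i))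
    have hcast := Fin.sum_univ_castSucc fun i => dInf (γ 0) (γ (t i))
    rw [h₀, dInf_self] at hsucc
    rw [h₁] at hcast
    rw [Finset.sum_congr rfl fun i _ => hstep i, Finset.sum_sub_distrib]
    linarith
  have hmono : StrictMono (![0, 1] : Fin 2 → unitInterval) := by
    simp [Fin.strictMono_iff_lt_succ]
  refine ⟨?_, fun x hx => hx ⟨1, one_pos, ![0, 1], hmono, rfl, rfl, (hsum 1 _ hmono rfl rfl).symm⟩⟩
  rintro x ⟨n, -, t, ht, h₀, h₁, rfl⟩
  exact (hsum n t ht h₀ h₁).le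

variable {γ : unitInterval → Pt S}

-- The bounds on `[0, a]`, `[a, b]` and `[b, 1]` add up to `dSym (γ 0) (γ 1)`, which forces equality
-- in every triangle inequality for `D_∞` in both directions.
theorem additive_of_dSym_le (hγ : ∀ a b, dSym (γ a) (γ b) ≤ |(b : ℝ) - a| * dSym (γ 0) (γ 1))
    {a b : unitInterval} (hab : a ≤ b) :
    dInf (γ 0) (γ a) + dInf (γ a) (γ b) = dInf (γ 0) (γ b) ∧
      dSym (γ a) (γ b) = (b - a) * dSym (γ 0) (γ 1) := by
  have hab' : (a : ℝ) ≤ b := hab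
  have h0a := hγ 0 a
  have hab := hγ a b
  have hb1 := hγ b 1
  simp only [Icc.coe_zero, Icc.coe_one, sub_zero] at h0a hb1
  rw [abs_of_nonneg a.2.1] at h0a
  rw [abs_of_nonneg (sub_nonneg.2 hab')] at hab
  rw [abs_of_nonneg (sub_nonneg.2 b.2.2)] at hb1
  have hfwd := dInf_triangle (γ 0) (γ a) (γ b)
  have hfwd' := dInf_triangle (γ 0) (γ b) (γ 1)
  have hbwd := dInf_triangle (γ b) (γ a) (γ 0)
  have hbwd' := dInf_triangle (γ 1) (γ b) (γ 0)
  unfold dSym at *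
  constructor <;> linarith

theorem isGeodesic_of_dSym_le {Z : Set (Pt S)}
    (h : ∀ p ∈ Z, ∀ q ∈ Z, ∃ γ : unitInterval → Pt S, (∀ t, γ t ∈ Z) ∧ γ 0 = p ∧ γ 1 = q ∧
      ∀ a b, dSym (γ a) (γ b) ≤ |(b : ℝ) - a| * dSym p q) : IsGeodesic Z := by
  intro p hp q hq hpq
  obtain ⟨γ, hZ, rfl, rfl, hγ⟩ := h p hp q hq
  have hpos : 0 < dSym (γ 0) (γ 1) := lt_of_not_ge fun h => hpq (eq_of_dSym_le_zero h)
  refine ⟨γ, ?_, fun a b hab => ?_, hZ, rfl, rfl,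
    hasLength_of_additive fun a b hab => (additive_of_dSym_le hγ hab).1⟩
  · refine (LipschitzWith.of_dist_le_mul (K := ⟨_, hpos.le⟩) fun a b => ?_).continuous
    refine (dist_le_dSym _ _).trans ((hγ a b).trans_eq ?_)
    rw [Subtype.dist_eq, Real.dist_eq, abs_sub_comm, mul_comm]
    rfl
  · wlog hle : a ≤ b generalizing a b
    · exact (this b a hab.symm (le_of_not_ge hle)).symm
    have hzero := (additive_of_dSym_le hγ hle).2
    rw [hab, dSym, dInf_self, add_zero, eq_comm, mul_eq_zero_iff_right hpos.ne', sub_eq_zero]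
      at hzero
    exact Subtype.ext hzero.symm

end Paths

section Retractions

variable {S : Type*} [Fintype S]

theorem continuousOn_of_dSym_le {C : Set (Pt S)} {f : Pt S → Pt S}
    (hf : ∀ p ∈ C, ∀ q ∈ C, dSym (f p) (f q) ≤ dSym p q) : ContinuousOn f C := by
  refine (LipschitzOnWith.of_dist_le_mul (K := 2) fun p hp q hq => ?_).continuousOn
  exact (dist_le_dSym _ _).trans ((hf p hp q hq).trans (dSym_le_two_mul_dist p q))

/-- `f` retracts `C` onto a copy of `Z` embedded in `C` by `ι`; both maps are nonexpansive for the
symmetrized distance and preserve terminal regions. -/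
structure IsRetraction (C Z : Set (Pt S)) (f ι : Pt S → Pt S) : Prop where
  mapsTo : MapsTo f C Z
  mapsTo_emb : MapsTo ι Z C
  leftInvOn : LeftInvOn f ι Z
  dSym_le : ∀ p ∈ C, ∀ q ∈ C, dSym (f p) (f q) ≤ dSym p q
  dSym_emb_le : ∀ p ∈ Z, ∀ q ∈ Z, dSym (ι p) (ι q) ≤ dSym p q
  terminal : ∀ p ∈ C, ∀ s, p (inl s) + p (inr s) = 0 → f p (inl s) + f p (inr s) = 0
  terminal_emb : ∀ p ∈ Z, ∀ s, p (inl s) + p (inr s) = 0 → ι p (inl s) + ι p (inr s) = 0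

namespace IsRetraction

variable {C Y Z : Set (Pt S)} {f g ι κ : Pt S → Pt S}

theorem trans (hf : IsRetraction C Y f ι) (hg : IsRetraction Y Z g κ) :
    IsRetraction C Z (g ∘ f) (ι ∘ κ) where
  mapsTo := hg.mapsTo.comp hf.mapsTo
  mapsTo_emb := hf.mapsTo_emb.comp hg.mapsTo_emb
  leftInvOn p hp := by
    rw [Function.comp_apply, Function.comp_apply, hf.leftInvOn (hg.mapsTo_emb hp), hg.leftInvOn hp]
  dSym_le p hp q hq :=
    (hg.dSym_le _ (hf.mapsTo hp) _ (hf.mapsTo hq)).trans (hf.dSym_le p hp q hq)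
  dSym_emb_le p hp q hq :=
    (hf.dSym_emb_le _ (hg.mapsTo_emb hp) _ (hg.mapsTo_emb hq)).trans (hg.dSym_emb_le p hp q hq)
  terminal p hp s h := hg.terminal _ (hf.mapsTo hp) s (hf.terminal p hp s h)
  terminal_emb p hp s h := hf.terminal_emb _ (hg.mapsTo_emb hp) s (hg.terminal_emb p hp s h)

theorem region (hf : IsRetraction C Z f ι) (s : S) :
    IsRetraction (region C s) (region Z s) f ι where
  mapsTo p hp := ⟨hf.mapsTo hp.1, hf.terminal p hp.1 s hp.2⟩
  mapsTo_emb p hp := ⟨hf.mapsTo_emb hp.1, hf.terminal_emb p hp.1 s hp.2⟩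
  leftInvOn _ hp := hf.leftInvOn hp.1
  dSym_le p hp q hq := hf.dSym_le p hp.1 q hq.1
  dSym_emb_le p hp q hq := hf.dSym_emb_le p hp.1 q hq.1
  terminal p hp := hf.terminal p hp.1
  terminal_emb p hp := hf.terminal_emb p hp.1

theorem contractibleSpace (hf : IsRetraction C Z f ι) (hC : Convex ℝ C) (hne : C.Nonempty) :
    ContractibleSpace Z := by
  have := hC.contractibleSpace hne
  let F : C(C, Z) := ⟨_, (continuousOn_of_dSym_le hf.dSym_le).mapsToRestrict hf.mapsTo⟩
  let I : C(Z, C) := ⟨_, (continuousOn_of_dSym_le hf.dSym_emb_le).mapsToRestrict hf.mapsTo_emb⟩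
  have hFI : F.comp I = ContinuousMap.id Z :=
    ContinuousMap.ext fun p => Subtype.ext (hf.leftInvOn p.2)
  rw [contractible_iff_id_nullhomotopic, ← hFI]
  exact ((id_nullhomotopic C).comp_left I).comp_right F

theorem isGeodesic (hf : IsRetraction C Z f ι) (hC : Convex ℝ C) : IsGeodesic Z := by
  refine isGeodesic_of_dSym_le fun p hp q hq =>
    ⟨fun t => f (lineMap (ι p) (ι q) (t : ℝ)), ?_, ?_, ?_, ?_⟩
  all_goals have hline (t : unitInterval) : lineMap (ι p) (ι q) (t : ℝ) ∈ C :=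
    hC.lineMap_mem (hf.mapsTo_emb hp) (hf.mapsTo_emb hq) t.2
  · exact fun t => hf.mapsTo (hline t)
  · simp [hf.leftInvOn hp]
  · simp [hf.leftInvOn hq]
  · intro a b
    calc dSym (f (lineMap (ι p) (ι q) (a : ℝ))) (f (lineMap (ι p) (ι q) (b : ℝ)))
        ≤ dSym (lineMap (ι p) (ι q) (a : ℝ)) (lineMap (ι p) (ι q) (b : ℝ)) :=
          hf.dSym_le _ (hline a) _ (hline b)
      _ ≤ |(b : ℝ) - a| * dSym (ι p) (ι q) := dSym_lineMap_le _ _ _ _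
      _ ≤ |(b : ℝ) - a| * dSym p q := by gcongr; exact hf.dSym_emb_le p hp q hq

end IsRetraction

end Retractions

section Swap

variable {S : Type*}

/-- The reversed distance. -/
abbrev tr (μ : S → S → ℝ) : S → S → ℝ := fun s t => μ t s

/-- Exchange of the two copies of `S`. It maps `P_μ` to the polyhedron of the reversed distance and
turns every statement about `S^c` into one about `S^r`. -/
def swapPt (p : Pt S) : Pt S := fun u => p u.swap

@[simp] theorem swapPt_inl (p : Pt S) (s : S) : swapPt p (inl s) = p (inr s) := rfl

@[simp] theorem swapPt_inr (p : Pt S) (s : S) : swapPt p (inr s) = p (inl s) := rfl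

@[simp] theorem swapPt_swapPt (p : Pt S) : swapPt (swapPt p) = p := by
  ext u
  simp [swapPt]

@[simp] theorem preimage_swapPt_preimage_swapPt (A : Set (Pt S)) :
    swapPt ⁻¹' (swapPt ⁻¹' A) = A := by
  ext p
  simp

theorem IsDirectedDistance.swap {μ : S → S → ℝ} (hμ : IsDirectedDistance μ) :
    IsDirectedDistance (tr μ) :=
  ⟨fun s t => hμ.nonneg t s, hμ.diag⟩

theorem swapPt_mem_P {μ : S → S → ℝ} {p : Pt S} : swapPt p ∈ P (tr μ) ↔ p ∈ P μ :=
  ⟨fun h s t => by simpa [add_comm] using h t s, fun h s t => by simpa [add_comm] using h t s⟩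

theorem swapPt_mem_nonnegPart_P {μ : S → S → ℝ} {p : Pt S} :
    swapPt p ∈ nonnegPart (P (tr μ)) ↔ p ∈ nonnegPart (P μ) :=
  and_congr swapPt_mem_P
    ⟨fun h u => by simpa [swapPt] using h u.swap, fun h u => h u.swap⟩

theorem minimal_swapPt {A B : Set (Pt S)} (hAB : ∀ q, swapPt q ∈ B ↔ q ∈ A) {p : Pt S}
    (hp : Minimal (· ∈ A) p) : Minimal (· ∈ B) (swapPt p) := by
  refine ⟨(hAB p).2 hp.1, fun q hq hle u => ?_⟩
  have hq' : swapPt q ∈ A := (hAB _).1 (by rwa [swapPt_swapPt])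
  simpa [swapPt] using hp.2 hq' (fun v => by simpa [swapPt] using hle v.swap) u.swap

variable [Fintype S]

theorem dInf_swapPt (p q : Pt S) : dInf (swapPt p) (swapPt q) = dInf q p := max_comm _ _

theorem dSym_swapPt (p q : Pt S) : dSym (swapPt p) (swapPt q) = dSym p q := by
  rw [dSym, dInf_swapPt, dInf_swapPt, add_comm, dSym]

theorem IsRetraction.swap {C Z : Set (Pt S)} {f ι : Pt S → Pt S}
    (hf : IsRetraction (swapPt ⁻¹' C) (swapPt ⁻¹' Z) f ι) :
    IsRetraction C Z (swapPt ∘ f ∘ swapPt) (swapPt ∘ ι ∘ swapPt) where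
  mapsTo p hp := hf.mapsTo (x := swapPt p) (by simpa using hp)
  mapsTo_emb p hp := hf.mapsTo_emb (x := swapPt p) (by simpa using hp)
  leftInvOn p hp := by
    have := hf.leftInvOn (x := swapPt p) (by simpa using hp)
    simp [this]
  dSym_le p hp q hq := by
    simpa [dSym_swapPt] using
      hf.dSym_le (swapPt p) (by simpa using hp) (swapPt q) (by simpa using hq)
  dSym_emb_le p hp q hq := by
    simpa [dSym_swapPt] using
      hf.dSym_emb_le (swapPt p) (by simpa using hp) (swapPt q) (by simpa using hq)
  terminal p hp s h := by
    simpa [add_comm] using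
      hf.terminal (swapPt p) (by simpa using hp) s (by simpa [add_comm] using h)
  terminal_emb p hp s h := by
    simpa [add_comm] using
      hf.terminal_emb (swapPt p) (by simpa using hp) s (by simpa [add_comm] using h)

end Swap

section TightSpan

variable {S : Type*} {μ : S → S → ℝ} {p q : Pt S}

/-- The tropical tight span `T_μ`: the minimal points of `P_μ^+`. -/
def tightSpan (μ : S → S → ℝ) : Set (Pt S) := {p | Minimal (· ∈ nonnegPart (P μ)) p}

theorem nonneg_of_mem_tightSpan (hp : p ∈ tightSpan μ) (u : S ⊕ S) : 0 ≤ p u := hp.1.2 u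

theorem le_of_mem_tightSpan (hp : p ∈ tightSpan μ) (s t : S) : μ s t ≤ p (inl s) + p (inr t) :=
  hp.1.1 s t

theorem swapPt_mem_tightSpan : swapPt p ∈ tightSpan (tr μ) ↔ p ∈ tightSpan μ := by
  refine ⟨fun h => ?_, minimal_swapPt fun _ => swapPt_mem_nonnegPart_P⟩
  rw [← swapPt_swapPt p]
  exact minimal_swapPt (fun _ => swapPt_mem_nonnegPart_P (μ := tr μ)) h

theorem nonnegPart_Q_subset_tightSpan : nonnegPart (Q μ) ⊆ tightSpan μ := fun _ hp =>
  ⟨⟨hp.1.1, hp.2⟩, fun _ hq hle => hp.1.2 hq.1 hle⟩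

theorem convex_nonnegPart_P (μ : S → S → ℝ) : Convex ℝ (nonnegPart (P μ)) := by
  intro p hp q hq a b ha hb hab
  refine ⟨fun s t => ?_, fun u => ?_⟩
  · simp only [Pi.add_apply, Pi.smul_apply, smul_eq_mul]
    calc μ s t = a * μ s t + b * μ s t := by rw [← add_mul, hab, one_mul]
      _ ≤ a * (p (inl s) + p (inr t)) + b * (q (inl s) + q (inr t)) := by
        gcongr
        · exact hp.1 s t
        · exact hq.1 s t
      _ = _ := by ring
  · exact add_nonneg (mul_nonneg ha (hp.2 u)) (mul_nonneg hb (hq.2 u))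

theorem convex_region {C : Set (Pt S)} (hC : Convex ℝ C) (s : S) : Convex ℝ (region C s) := by
  intro p hp q hq a b ha hb hab
  refine ⟨hC hp.1 hq.1 ha hb hab, ?_⟩
  simp only [Pi.add_apply, Pi.smul_apply, smul_eq_mul]
  linear_combination a * hp.2 + b * hq.2

theorem inr_le_add (hp : p ∈ tightSpan μ) (hq : q ∈ nonnegPart (P μ)) {a : ℝ} (ha : 0 ≤ a)
    (h : ∀ s, q (inl s) ≤ p (inl s) + a) (t : S) : p (inr t) ≤ q (inr t) + a := by
  let r : Pt S := Sum.elim (fun s => p (inl s)) fun t => min (p (inr t)) (q (inr t) + a)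
  have hr : r ∈ nonnegPart (P μ) := by
    refine ⟨fun s t => ?_, ?_⟩
    · change μ s t ≤ p (inl s) + min (p (inr t)) (q (inr t) + a)
      rw [← min_add_add_left]
      exact le_min (hp.1.1 s t) (by linarith [hq.1 s t, h s])
    · rintro (s | t)
      · exact hp.1.2 _
      · exact le_min (hp.1.2 _) (add_nonneg (hq.2 _) ha)
  have hle : r ≤ p := by
    rintro (s | t)
    · exact le_rfl
    · exact min_le_left _ _
  exact (hp.2 hr hle (inr t)).trans (min_le_right _ _)

theorem inl_le_add (hp : p ∈ tightSpan μ) (hq : q ∈ nonnegPart (P μ)) {a : ℝ} (ha : 0 ≤ a)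
    (h : ∀ t, q (inr t) ≤ p (inr t) + a) (s : S) : p (inl s) ≤ q (inl s) + a :=
  inr_le_add (swapPt_mem_tightSpan.2 hp) (swapPt_mem_nonnegPart_P.2 hq) ha h s

theorem eq_of_inl_eq (hp : p ∈ tightSpan μ) (hq : q ∈ tightSpan μ)
    (h : ∀ s, p (inl s) = q (inl s)) : p = q := by
  ext (s | t)
  · exact h s
  · refine le_antisymm ?_ ?_
    · simpa using inr_le_add hp hq.1 le_rfl (fun s => by simp [h s]) t
    · simpa using inr_le_add hq hp.1 le_rfl (fun s => by simp [h s]) t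

end TightSpan

section Hull

variable {S : Type*} {μ : S → S → ℝ} {p q : Pt S} [Fintype S]

/-- The least nonnegative `y` with `x s + y t ≥ μ s t` for all `s`, `t`. -/
noncomputable def dual (μ : S → S → ℝ) (x : S → ℝ) (t : S) : ℝ := dPlus x (μ · t)

theorem dual_nonneg (μ : S → S → ℝ) (x : S → ℝ) (t : S) : 0 ≤ dual μ x t := dPlus_nonneg _ _

theorem dual_le_iff {x : S → ℝ} {t : S} {a : ℝ} :
    dual μ x t ≤ a ↔ 0 ≤ a ∧ ∀ s, μ s t ≤ x s + a := dPlus_le_iff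

theorem le_add_dual (μ : S → S → ℝ) (x : S → ℝ) (s t : S) : μ s t ≤ x s + dual μ x t :=
  (dual_le_iff.1 le_rfl).2 s

theorem dual_eq_zero_or (μ : S → S → ℝ) (x : S → ℝ) (t : S) :
    dual μ x t = 0 ∨ ∃ s, x s + dual μ x t = μ s t := by
  by_contra! h
  have hlt (s : S) : μ s t < x s + dual μ x t := (le_add_dual μ x s t).lt_of_ne' (h.2 s)
  have hnhds : ∀ᶠ a in 𝓝 (dual μ x t), 0 < a ∧ ∀ s, μ s t < x s + a :=
    (eventually_gt_nhds ((dual_nonneg μ x t).lt_of_ne' h.1)).and <| eventually_all.2 fun s =>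
      (continuous_const.add continuous_id).continuousAt.eventually_const_lt (hlt s)
  obtain ⟨a, ⟨ha, hμ⟩, hlt⟩ := ((hnhds.filter_mono nhdsWithin_le_nhds).and
    (self_mem_nhdsWithin (s := Iio (dual μ x t)))).exists
  exact hlt.not_ge (dual_le_iff.2 ⟨ha.le, fun s => (hμ s).le⟩)

theorem dual_le_dual_add {x y : S → ℝ} {a : ℝ} (ha : 0 ≤ a) (h : ∀ s, y s ≤ x s + a) (t : S) :
    dual μ x t ≤ dual μ y t + a :=
  dual_le_iff.2 ⟨add_nonneg (dual_nonneg _ _ _) ha, fun s => by linarith [h s, le_add_dual μ y s t]⟩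

theorem dual_anti {x y : S → ℝ} (h : y ≤ x) : dual μ x ≤ dual μ y := fun t => by
  simpa using dual_le_dual_add (μ := μ) le_rfl (fun s => by simpa using h s) t

theorem dual_inl_le (hp : p ∈ nonnegPart (P μ)) (t : S) :
    dual μ (fun s => p (inl s)) t ≤ p (inr t) :=
  dual_le_iff.2 ⟨hp.2 _, fun s => hp.1 s t⟩

/-- The point of the tight span generated by `x`: the least point of `P_μ^+` whose `S^r`-part is
the dual of `x`. -/
noncomputable def hull (μ : S → S → ℝ) (x : S → ℝ) : Pt S :=
  Sum.elim (dual (tr μ) (dual μ x)) (dual μ x)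

@[simp] theorem hull_inr (μ : S → S → ℝ) (x : S → ℝ) (t : S) : hull μ x (inr t) = dual μ x t := rfl

@[simp] theorem hull_inl (μ : S → S → ℝ) (x : S → ℝ) (s : S) :
    hull μ x (inl s) = dual (tr μ) (dual μ x) s := rfl

theorem hull_inl_le {x : S → ℝ} (hx : 0 ≤ x) (s : S) : hull μ x (inl s) ≤ x s :=
  dual_le_iff.2 ⟨hx s, fun t => by linarith [le_add_dual μ x s t]⟩

theorem hull_mem_tightSpan (μ : S → S → ℝ) {x : S → ℝ} (hx : 0 ≤ x) : hull μ x ∈ tightSpan μ := by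
  refine ⟨⟨fun s t => ?_, ?_⟩, fun q hq hle => ?_⟩
  · simpa [add_comm] using le_add_dual (tr μ) (dual μ x) t s
  · rintro (s | s) <;> exact dual_nonneg _ _ _
  · rintro (s | t)
    · calc hull μ x (inl s) ≤ dual (tr μ) (fun t => q (inr t)) s :=
          dual_anti (fun t => hle (inr t)) s
        _ ≤ q (inl s) := dual_inl_le (swapPt_mem_nonnegPart_P.2 hq) s
    · calc dual μ x t ≤ dual μ (fun s => q (inl s)) t :=
          dual_anti (fun s => (hle (inl s)).trans (hull_inl_le hx s)) t
        _ ≤ q (inr t) := dual_inl_le hq t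

theorem hull_le (hp : p ∈ nonnegPart (P μ)) : hull μ (fun s => p (inl s)) ≤ p := by
  rintro (s | t)
  · exact hull_inl_le (fun s => hp.2 _) s
  · exact dual_inl_le hp t

theorem hull_eq (hp : p ∈ tightSpan μ) : hull μ (fun s => p (inl s)) = p :=
  hp.eq_of_le (hull_mem_tightSpan μ fun _ => nonneg_of_mem_tightSpan hp _).1 (hull_le hp.1)

theorem inr_eq_dual (hp : p ∈ tightSpan μ) (t : S) : p (inr t) = dual μ (fun s => p (inl s)) t := by
  rw [← hull_inr, hull_eq hp]

theorem dInf_le_of_inl_le (hp : p ∈ tightSpan μ) (hq : q ∈ nonnegPart (P μ)) {a : ℝ} (ha : 0 ≤ a)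
    (h : ∀ s, q (inl s) ≤ p (inl s) + a) : dInf p q ≤ a :=
  dInf_le_iff.2 ⟨ha, h, inr_le_add hp hq ha h⟩

theorem dInf_hull_le (μ : S → S → ℝ) (x y : S → ℝ) : dInf (hull μ x) (hull μ y) ≤ dPlus x y := by
  have h₀ := dPlus_nonneg x y
  have h := dual_le_dual_add (μ := μ) h₀ (dPlus_le_iff.1 le_rfl).2
  exact dInf_le_iff.2 ⟨h₀, dual_le_dual_add h₀ h, h⟩

theorem isRetraction_hull (μ : S → S → ℝ) :
    IsRetraction (nonnegPart (P μ)) (tightSpan μ) (fun p => hull μ fun s => p (inl s)) id where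
  mapsTo _ hp := hull_mem_tightSpan μ fun _ => hp.2 _
  mapsTo_emb _ hp := hp.1
  leftInvOn _ hp := hull_eq hp
  dSym_le p _ q _ := add_le_add ((dInf_hull_le μ _ _).trans (le_max_left _ _))
    ((dInf_hull_le μ _ _).trans (le_max_left _ _))
  dSym_emb_le _ _ _ _ := le_rfl
  terminal p hp s h := by
    have hT := hull_mem_tightSpan μ (x := fun s => p (inl s)) fun _ => hp.2 _
    linarith [hull_le hp (inl s), hull_le hp (inr s), nonneg_of_mem_tightSpan hT (inl s),
      nonneg_of_mem_tightSpan hT (inr s)]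
  terminal_emb _ _ _ h := h

end Hull

section Edges

variable {S : Type*} [Finite S] {μ : S → S → ℝ} {p : Pt S}

theorem inr_eq_zero_or (hp : p ∈ tightSpan μ) (t : S) :
    p (inr t) = 0 ∨ ∃ s, p (inl s) + p (inr t) = μ s t := by
  cases nonempty_fintype S
  rw [inr_eq_dual hp]
  exact dual_eq_zero_or _ _ _

theorem inl_eq_zero_or (hp : p ∈ tightSpan μ) (s : S) :
    p (inl s) = 0 ∨ ∃ t, p (inl s) + p (inr t) = μ s t := by
  simpa [add_comm] using inr_eq_zero_or (swapPt_mem_tightSpan.2 hp) s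

end Edges

section Flow

variable {S : Type*} [Fintype S] {μ : S → S → ℝ} {p q : Pt S} {a b t : ℝ}

/-- The downward flow on the tight span: the `S^c`-coordinates decrease at unit speed until they
vanish. -/
noncomputable def flow (μ : S → S → ℝ) (t : ℝ) (p : Pt S) : Pt S :=
  hull μ fun s => max (p (inl s) - t) 0

theorem flow_mem_tightSpan (μ : S → S → ℝ) (t : ℝ) (p : Pt S) : flow μ t p ∈ tightSpan μ :=
  hull_mem_tightSpan μ fun _ => le_max_right _ _

theorem continuous_flow (μ : S → S → ℝ) (p : Pt S) : Continuous fun t => flow μ t p := by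
  refine continuous_pi ?_
  rintro (s | s) <;> simp only [flow, hull_inl, hull_inr, dual, dPlus] <;> fun_prop

theorem flow_inr_le (hp : p ∈ tightSpan μ) (ht : 0 ≤ t) (v : S) :
    flow μ t p (inr v) ≤ p (inr v) + t :=
  dual_le_iff.2 ⟨add_nonneg (nonneg_of_mem_tightSpan hp _) ht, fun s => by
    linarith [le_of_mem_tightSpan hp s v, le_max_left (p (inl s) - t) 0]⟩

theorem flow_inl (hp : p ∈ tightSpan μ) (ht : 0 ≤ t) (s : S) :
    flow μ t p (inl s) = max (p (inl s) - t) 0 := by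
  have hT := flow_mem_tightSpan μ t p
  refine le_antisymm (hull_inl_le (fun _ => le_max_right _ _) s)
    (max_le ?_ (nonneg_of_mem_tightSpan hT _))
  linarith [inl_le_add hp hT.1 ht (flow_inr_le hp ht) s]

theorem flow_inl_le (hp : p ∈ tightSpan μ) (ht : 0 ≤ t) (s : S) :
    flow μ t p (inl s) ≤ p (inl s) := by
  rw [flow_inl hp ht]
  exact max_le (by linarith) (nonneg_of_mem_tightSpan hp _)

theorem flow_zero (hp : p ∈ tightSpan μ) : flow μ 0 p = p :=
  eq_of_inl_eq (flow_mem_tightSpan μ 0 p) hp fun s => by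
    rw [flow_inl hp le_rfl, sub_zero, max_eq_left (nonneg_of_mem_tightSpan hp _)]

theorem flow_flow (hp : p ∈ tightSpan μ) (ha : 0 ≤ a) (hb : 0 ≤ b) :
    flow μ b (flow μ a p) = flow μ (a + b) p := by
  have hT := flow_mem_tightSpan μ a p
  refine eq_of_inl_eq (flow_mem_tightSpan _ _ _) (flow_mem_tightSpan _ _ _) fun s => ?_
  rw [flow_inl hT hb, flow_inl hp ha, flow_inl hp (add_nonneg ha hb)]
  grind

theorem flow_dInf_inl_le (hp : p ∈ tightSpan μ) (hq : q ∈ tightSpan μ) (s : S) :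
    flow μ (dInf q p) p (inl s) ≤ q (inl s) := by
  rw [flow_inl hp (dInf_nonneg _ _)]
  exact max_le (by linarith [inl_le_add_dInf q p s]) (nonneg_of_mem_tightSpan hq _)

theorem dInf_flow_le (hp : p ∈ tightSpan μ) (ht : 0 ≤ t) : dInf (flow μ t p) p ≤ t :=
  dInf_le_of_inl_le (flow_mem_tightSpan _ _ _) hp.1 ht fun s => by
    rw [flow_inl hp ht]
    linarith [le_max_left (p (inl s) - t) 0]

-- Flowing down for time `t` raises `D_∞(p, q)` by at most `t` and lowers `D_∞(q, p)` by `t`.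
theorem dSym_flow_le (hp : p ∈ tightSpan μ) (hq : q ∈ tightSpan μ) (ht : 0 ≤ t)
    (htq : t ≤ dInf q p) : dSym (flow μ t p) q ≤ dSym p q := by
  have hback : dInf q (flow μ t p) ≤ dInf q p - t := by
    refine dInf_le_of_inl_le hq (flow_mem_tightSpan μ t p).1 (sub_nonneg.2 htq) fun s => ?_
    rw [flow_inl hp ht]
    exact max_le (by linarith [inl_le_add_dInf q p s])
      (add_nonneg (nonneg_of_mem_tightSpan hq _) (sub_nonneg.2 htq))
  unfold dSym
  linarith [dInf_triangle (flow μ t p) p q, dInf_flow_le hp ht]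

theorem dSym_flow_flow_le (μ : S → S → ℝ) (p q : Pt S) (t : ℝ) :
    dSym (flow μ t p) (flow μ t q) ≤ dSym p q := by
  have hdInf (p q : Pt S) : dInf (flow μ t p) (flow μ t q) ≤ dInf p q := by
    refine (dInf_hull_le _ _ _).trans (dPlus_le_iff.2 ⟨dInf_nonneg _ _, fun s => ?_⟩)
    refine max_le ?_ (add_nonneg (le_max_right _ _) (dInf_nonneg _ _))
    linarith [inl_le_add_dInf p q s, le_max_left (p (inl s) - t) 0]
  exact add_le_add (hdInf p q) (hdInf q p)

end Flow

section Landing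

variable {S : Type*} {μ : S → S → ℝ} {D U : Set (Pt S)} {p q : Pt S}

/-- The terminals whose region contains the nonnegative point `p`. -/
def zeroSet (p : Pt S) : Set S := {s | p (inl s) = 0 ∧ p (inr s) = 0}

theorem mem_zeroSet_iff_add_eq_zero (hp : ∀ u, 0 ≤ p u) {s : S} :
    s ∈ zeroSet p ↔ p (inl s) + p (inr s) = 0 :=
  (add_eq_zero_iff_of_nonneg (hp _) (hp _)).symm

/-- A part of the tight span that the downward flow leaves in finite time, never to return, and
inside which the flow does not leave any terminal region. -/
structure IsFlowDomain (μ : S → S → ℝ) (D : Set (Pt S)) : Prop where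
  subset : D ⊆ tightSpan μ
  upper : ∀ p ∈ D, ∀ q ∈ tightSpan μ, (∀ s, p (inl s) ≤ q (inl s)) → q ∈ D
  mem_nhdsWithin : ∀ p ∈ D, D ∈ 𝓝[tightSpan μ] p
  exists_pos : ∀ p ∈ D, ∃ s, 0 < p (inl s)
  zeroSet_anti : ∀ p ∈ D, ∀ q ∈ tightSpan μ, (∀ s, p (inl s) ≤ q (inl s)) → zeroSet q ⊆ zeroSet p

variable [Fintype S]

/-- The time at which the flow line of `p` leaves `D`. -/
noncomputable def landingTime (μ : S → S → ℝ) (D : Set (Pt S)) (p : Pt S) : ℝ :=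
  sInf {t | 0 ≤ t ∧ flow μ t p ∉ D}

/-- The point at which the flow line of `p` leaves `D`. -/
noncomputable def land (μ : S → S → ℝ) (D : Set (Pt S)) (p : Pt S) : Pt S :=
  flow μ (landingTime μ D p) p

theorem land_mem_tightSpan (μ : S → S → ℝ) (D : Set (Pt S)) (p : Pt S) :
    land μ D p ∈ tightSpan μ := flow_mem_tightSpan _ _ _

theorem landingTime_nonneg (μ : S → S → ℝ) (D : Set (Pt S)) (p : Pt S) :
    0 ≤ landingTime μ D p := Real.sInf_nonneg fun _ ht => ht.1

theorem landingTime_le {t : ℝ} (ht : 0 ≤ t) (htD : flow μ t p ∉ D) : landingTime μ D p ≤ t :=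
  csInf_le ⟨0, fun _ h => h.1⟩ ⟨ht, htD⟩

theorem flow_mem_of_lt_landingTime {t : ℝ} (ht : 0 ≤ t) (htD : t < landingTime μ D p) :
    flow μ t p ∈ D := by
  by_contra h
  exact htD.not_ge (landingTime_le ht h)

theorem land_eq_self (hp : p ∈ tightSpan μ) (hpD : p ∉ D) : land μ D p = p := by
  have hzero : landingTime μ D p = 0 :=
    (landingTime_le le_rfl (by rwa [flow_zero hp])).antisymm (landingTime_nonneg _ _ _)
  rw [land, hzero, flow_zero hp]

namespace IsFlowDomain

theorem land_notMem (hD : IsFlowDomain μ D) (hp : p ∈ tightSpan μ) : land μ D p ∉ D := by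
  have hclosed : IsClosed {t | 0 ≤ t ∧ flow μ t p ∉ D} := by
    refine isClosed_Ici.inter (isOpen_iff_mem_nhds.2 fun t ht => ?_).isClosed_compl
    exact (tendsto_nhdsWithin_iff.2 ⟨(continuous_flow μ p).tendsto t,
      .of_forall fun _ => flow_mem_tightSpan _ _ _⟩) (hD.mem_nhdsWithin _ ht)
  refine (hclosed.csInf_mem ⟨‖p‖, norm_nonneg p, fun hmem => ?_⟩ ⟨0, fun _ h => h.1⟩).2
  obtain ⟨s, hs⟩ := hD.exists_pos _ hmem
  rw [flow_inl hp (norm_nonneg p)] at hs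
  have := (le_abs_self _).trans (norm_le_pi_norm p (inl s))
  exact hs.not_ge (max_le (by linarith) le_rfl)

theorem landingTime_le_add_dInf (hD : IsFlowDomain μ D) (hp : p ∈ tightSpan μ)
    (hq : q ∈ tightSpan μ) (hqD : q ∉ D) {a : ℝ} (ha : 0 ≤ a) :
    landingTime μ D p ≤ a + dInf q (flow μ a p) := by
  refine landingTime_le (add_nonneg ha (dInf_nonneg _ _)) fun hmem => hqD ?_
  rw [← flow_flow hp ha (dInf_nonneg _ _)] at hmem
  exact hD.upper _ hmem q hq (flow_dInf_inl_le (flow_mem_tightSpan _ _ _) hq)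

theorem dSym_land_le (hD : IsFlowDomain μ D) (hp : p ∈ tightSpan μ) (hq : q ∈ tightSpan μ) :
    dSym (land μ D p) (land μ D q) ≤ dSym p q := by
  wlog hle : landingTime μ D p ≤ landingTime μ D q generalizing p q
  · rw [dSym_comm, dSym_comm p]
    exact this hq hp (le_of_not_ge hle)
  have ha := landingTime_nonneg μ D p
  have hlater := hD.landingTime_le_add_dInf hq (land_mem_tightSpan _ _ _) (hD.land_notMem hp) ha
  have hland : land μ D q =
      flow μ (landingTime μ D q - landingTime μ D p) (flow μ (landingTime μ D p) q) := by
    rw [flow_flow hq ha (sub_nonneg.2 hle), add_sub_cancel, land]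
  calc dSym (land μ D p) (land μ D q)
      ≤ dSym (flow μ (landingTime μ D p) q) (land μ D p) := by
        rw [dSym_comm, hland]
        exact dSym_flow_le (flow_mem_tightSpan _ _ _) (land_mem_tightSpan _ _ _)
          (sub_nonneg.2 hle) (by linarith)
    _ ≤ dSym p q := by
        rw [dSym_comm]
        exact dSym_flow_flow_le μ p q _

theorem land_mem_closure (hD : IsFlowDomain μ D) (hp : p ∈ D) :
    land μ D p ∈ closure ((fun t => flow μ t p) '' Ico 0 (landingTime μ D p)) := by
  have hne : 0 ≠ landingTime μ D p := fun h => by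
    have hland := hD.land_notMem (hD.subset hp)
    rw [land, ← h, flow_zero (hD.subset hp)] at hland
    exact hland hp
  refine image_closure_subset_closure_image (continuous_flow μ p) (mem_image_of_mem _ ?_)
  rw [closure_Ico hne]
  exact right_mem_Icc.2 (landingTime_nonneg _ _ _)

theorem zeroSet_subset_zeroSet_land (hD : IsFlowDomain μ D) (hp : p ∈ tightSpan μ) :
    zeroSet p ⊆ zeroSet (land μ D p) := by
  by_cases hpD : p ∈ D
  · intro s hs
    have hclosed : IsClosed {r : Pt S | s ∈ zeroSet r} :=
      (isClosed_eq (continuous_apply _) continuous_const).inter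
        (isClosed_eq (continuous_apply _) continuous_const)
    refine closure_minimal ?_ hclosed (hD.land_mem_closure hpD)
    rintro _ ⟨t, ht, rfl⟩
    exact hD.zeroSet_anti _ (flow_mem_of_lt_landingTime ht.1 ht.2) p hp (flow_inl_le hp ht.1) hs
  · rw [land_eq_self hp hpD]

theorem mapsTo_land (hD : IsFlowDomain μ D) (hU : ∀ p ∈ U, U ∈ 𝓝[tightSpan μ] p)
    (hDU : Disjoint D U) : MapsTo (land μ D) (tightSpan μ \ U) (tightSpan μ \ U) := by
  refine fun p hp => ⟨land_mem_tightSpan _ _ _, fun hland => ?_⟩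
  by_cases hpD : p ∈ D
  · have hflow : (fun t => flow μ t p) '' Ico 0 (landingTime μ D p) ⊆ D :=
      image_subset_iff.2 fun t ht => flow_mem_of_lt_landingTime ht.1 ht.2
    have := mem_closure_iff_nhdsWithin_neBot.1 (hD.land_mem_closure hpD)
    have hmem := nhdsWithin_mono _ (hflow.trans hD.subset) (hU _ hland)
    obtain ⟨r, hrU, hrD⟩ := Filter.nonempty_of_mem (inter_mem hmem self_mem_nhdsWithin)
    exact disjoint_left.1 hDU (hflow hrD) hrU
  · rw [land_eq_self hp.1 hpD] at hland
    exact hp.2 hland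

theorem isRetraction_land (hD : IsFlowDomain μ D) {C : Set (Pt S)} (hC : C ⊆ tightSpan μ)
    (hland : MapsTo (land μ D) C C) : IsRetraction C (C \ D) (land μ D) id where
  mapsTo _ hp := ⟨hland hp, hD.land_notMem (hC hp)⟩
  mapsTo_emb _ hp := hp.1
  leftInvOn _ hp := land_eq_self (hC hp.1) hp.2
  dSym_le _ hp _ hq := hD.dSym_land_le (hC hp) (hC hq)
  dSym_emb_le _ _ _ _ := le_rfl
  terminal p hp s h := by
    rw [← mem_zeroSet_iff_add_eq_zero (nonneg_of_mem_tightSpan (hC hp))] at h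
    rw [← mem_zeroSet_iff_add_eq_zero (nonneg_of_mem_tightSpan (land_mem_tightSpan _ _ _))]
    exact hD.zeroSet_subset_zeroSet_land (hC hp) h
  terminal_emb _ _ _ h := h

theorem exists_isRetraction_diff (hD : IsFlowDomain μ D)
    (hU : IsFlowDomain (tr μ) (swapPt ⁻¹' U)) (hDU : Disjoint D U) :
    ∃ f ι, IsRetraction (tightSpan μ) ((tightSpan μ \ D) \ U) f ι := by
  have hpre : swapPt ⁻¹' (tightSpan μ \ D) = tightSpan (tr μ) \ swapPt ⁻¹' D := by
    ext p
    exact and_congr_left' (swapPt_mem_tightSpan (μ := tr μ))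
  have hcont : Continuous (swapPt (S := S)) := continuous_pi fun u => continuous_apply u.swap
  have hopen (p) (hp : p ∈ swapPt ⁻¹' D) : swapPt ⁻¹' D ∈ 𝓝[tightSpan (tr μ)] p :=
    (tendsto_nhdsWithin_iff.2 ⟨(hcont.tendsto p).mono_left nhdsWithin_le_nhds,
      eventually_mem_nhdsWithin.mono fun _ => (swapPt_mem_tightSpan (μ := tr μ)).2⟩)
      (hD.mem_nhdsWithin _ hp)
  have hdown := hD.isRetraction_land subset_rfl fun p _ => land_mem_tightSpan μ D p
  have hup := hU.isRetraction_land (C := swapPt ⁻¹' (tightSpan μ \ D)) (hpre ▸ sdiff_subset)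
    (hpre ▸ hU.mapsTo_land hopen (hDU.symm.preimage _))
  exact ⟨_, _, hdown.trans (IsRetraction.swap hup)⟩

end IsFlowDomain

end Landing

section Fats

variable {S : Type*} {μ : S → S → ℝ} {p q : Pt S} {Z : Set S} {a : ℝ}

/-- On `S^c \ Z^c` the point `q` is positive and, provided that `q` vanishes on `Z^r`, no edge of
`K(q)` leads from there to `Z^r`. -/
def DownFatOn (μ : S → S → ℝ) (Z : Set S) (q : Pt S) : Prop :=
  ∀ u ∉ Z, 0 < q (inl u) ∧ ∀ s ∈ Z, μ u s < q (inl u)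

/-- The inclusion `N_p(S^c \ X^c) ⊆ S^r \ X^r` of the definition of a fat, for the zero set `X` of
`p`, together with positivity off `X`. Down-fats are the points that flow downwards. -/
def DownFat (μ : S → S → ℝ) (p : Pt S) : Prop := DownFatOn μ (zeroSet p) p

/-- Some node of `S^r \ X^r`, for the zero set `X` of `p`, has no neighbour in `S^c \ X^c`. For a
down-fat this says that the inclusion of its definition is strict. -/
def DownFree (μ : S → S → ℝ) (p : Pt S) : Prop :=
  ∃ v ∉ zeroSet p, ∀ u ∉ zeroSet p, μ u v < p (inl u) + p (inr v)

/-- The mirror image of `DownFat`. -/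
abbrev UpFat (μ : S → S → ℝ) (p : Pt S) : Prop := DownFat (tr μ) (swapPt p)

/-- The mirror image of `DownFree`. -/
abbrev UpFree (μ : S → S → ℝ) (p : Pt S) : Prop := DownFree (tr μ) (swapPt p)

/-- The translate of `p` by `a (𝟙, -𝟙)` outside the zero set of `p`. -/
noncomputable def shift (p : Pt S) (a : ℝ) : Pt S := p + a • dirVec (zeroSet p)ᶜ

@[simp] theorem zeroSet_swapPt (p : Pt S) : zeroSet (swapPt p) = zeroSet p :=
  Set.ext fun _ => and_comm

theorem shift_inl_of_notMem {s : S} (hs : s ∉ zeroSet p) (a : ℝ) :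
    shift p a (inl s) = p (inl s) + a := by
  simp [shift, dirVec, hs]

theorem shift_inr_of_notMem {s : S} (hs : s ∉ zeroSet p) (a : ℝ) :
    shift p a (inr s) = p (inr s) - a := by
  simp [shift, dirVec, hs, sub_eq_add_neg]

theorem shift_inl_of_mem {s : S} (hs : s ∈ zeroSet p) (a : ℝ) :
    shift p a (inl s) = p (inl s) := by
  simp [shift, dirVec, hs]

theorem shift_inr_of_mem {s : S} (hs : s ∈ zeroSet p) (a : ℝ) :
    shift p a (inr s) = p (inr s) := by
  simp [shift, dirVec, hs]

@[simp] theorem shift_zero (p : Pt S) : shift p 0 = p := by simp [shift]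

theorem shift_eq_self_of_zeroSet_eq_univ (hp : zeroSet p = univ) (a : ℝ) : shift p a = p := by
  ext (s | s)
  · exact shift_inl_of_mem (hp ▸ mem_univ s) a
  · exact shift_inr_of_mem (hp ▸ mem_univ s) a

theorem swapPt_shift (p : Pt S) (a : ℝ) : swapPt (shift p a) = shift (swapPt p) (-a) := by
  ext (s | s) <;> simp [shift, dirVec]

theorem zeroSet_shift (hp : ∀ u, 0 ≤ p u) (a : ℝ) : zeroSet (shift p a) = zeroSet p := by
  ext s
  by_cases hs : s ∈ zeroSet p
  · refine iff_of_true ⟨?_, ?_⟩ hs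
    · rw [shift_inl_of_mem hs, hs.1]
    · rw [shift_inr_of_mem hs, hs.2]
  · refine iff_of_false (fun h => hs ?_) hs
    rw [mem_zeroSet_iff_add_eq_zero hp]
    have hc := h.1
    have hr := h.2
    rw [shift_inl_of_notMem hs] at hc
    rw [shift_inr_of_notMem hs] at hr
    linarith

theorem shift_shift (hp : ∀ u, 0 ≤ p u) (a b : ℝ) : shift (shift p a) b = shift p (a + b) := by
  rw [shift, zeroSet_shift hp, shift, shift, add_smul, add_assoc]

theorem downFree_shift (hp : ∀ u, 0 ≤ p u) (a : ℝ) : DownFree μ (shift p a) ↔ DownFree μ p := by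
  simp only [DownFree, zeroSet_shift hp]
  refine exists_congr fun v => and_congr_right fun hv => forall₂_congr fun u hu => ?_
  rw [shift_inl_of_notMem hu, shift_inr_of_notMem hv, add_add_sub_cancel]

theorem downFat_shift (hp : p ∈ nonnegPart (P μ)) (ha : 0 < a) : DownFat μ (shift p a) := by
  rw [DownFat, zeroSet_shift hp.2]
  intro u hu
  rw [shift_inl_of_notMem hu]
  exact ⟨add_pos_of_nonneg_of_pos (hp.2 _) ha, fun s hs => by linarith [hp.1 u s, hs.2]⟩

theorem upFat_shift (hp : p ∈ nonnegPart (P μ)) (ha : a < 0) : UpFat μ (shift p a) := by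
  rw [UpFat, swapPt_shift]
  exact downFat_shift (swapPt_mem_nonnegPart_P.2 hp) (neg_pos.2 ha)

theorem le_zero_of_mem_zeroSet (hp : p ∈ P μ) {s t : S} (hs : s ∈ zeroSet p)
    (ht : t ∈ zeroSet p) : μ s t ≤ 0 := by
  linarith [hp s t, hs.1, ht.2]

theorem DownFatOn.zeroSet_subset (hfat : DownFatOn μ Z q) : zeroSet q ⊆ Z := fun s hs => by
  by_contra h
  exact (hfat s h).1.ne' hs.1

variable [Finite S]

theorem DownFat.not_upFree (hfat : DownFat μ p) (hp : p ∈ tightSpan μ) : ¬ UpFree μ p := by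
  rintro ⟨v, hv, hfree⟩
  rw [zeroSet_swapPt] at hv hfree
  obtain ⟨hpos, hlt⟩ := hfat v hv
  obtain ⟨t, ht⟩ := (inl_eq_zero_or hp v).resolve_left hpos.ne'
  by_cases htZ : t ∈ zeroSet p
  · linarith [hlt t htZ, htZ.2]
  · exact (hfree t htZ).ne' (by simpa [add_comm] using ht)

theorem UpFat.not_downFree (hfat : UpFat μ p) (hp : p ∈ tightSpan μ) : ¬ DownFree μ p := by
  have := DownFat.not_upFree hfat (swapPt_mem_tightSpan.2 hp)
  rwa [UpFree, swapPt_swapPt] at this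

namespace DownFatOn

theorem inr_eq_zero (hfat : DownFatOn μ (zeroSet p) q) (hp : p ∈ P μ) (hq : q ∈ tightSpan μ)
    {s : S} (hs : s ∈ zeroSet p) : q (inr s) = 0 := by
  by_contra hne
  have hpos : 0 < q (inr s) := (nonneg_of_mem_tightSpan hq _).lt_of_ne' hne
  obtain ⟨u, hu⟩ := (inr_eq_zero_or hq s).resolve_left hne
  by_cases huZ : u ∈ zeroSet p
  · linarith [le_zero_of_mem_zeroSet hp huZ hs, nonneg_of_mem_tightSpan hq (inl u)]
  · linarith [(hfat u huZ).2 s hs]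

theorem downFat (hfat : DownFatOn μ (zeroSet p) q) (hp : p ∈ P μ) (hq : q ∈ tightSpan μ) :
    DownFat μ q := by
  intro u hu
  by_cases huZ : u ∈ zeroSet p
  · have hpos : 0 < q (inl u) := (nonneg_of_mem_tightSpan hq _).lt_of_ne'
      fun h => hu ⟨h, hfat.inr_eq_zero hp hq huZ⟩
    exact ⟨hpos, fun s hs => (le_zero_of_mem_zeroSet hp huZ (hfat.zeroSet_subset hs)).trans_lt hpos⟩
  · exact ⟨(hfat u huZ).1, fun s hs => (hfat u huZ).2 s (hfat.zeroSet_subset hs)⟩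

theorem downFree (hfat : DownFatOn μ (zeroSet p) q) (hp : p ∈ P μ) (hq : q ∈ tightSpan μ)
    (hne : zeroSet q ≠ zeroSet p) : DownFree μ q := by
  obtain ⟨v, hvZ, hv⟩ := exists_of_ssubset (hfat.zeroSet_subset.ssubset_of_ne hne)
  refine ⟨v, hv, fun u hu => ?_⟩
  rw [hfat.inr_eq_zero hp hq hvZ, add_zero]
  by_cases huZ : u ∈ zeroSet p
  · exact (le_zero_of_mem_zeroSet hp huZ hvZ).trans_lt (hfat.downFat hp hq u hu).1
  · exact (hfat u huZ).2 v hvZ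

end DownFatOn

end Fats

section Core

variable {S : Type*} {μ : S → S → ℝ} {R : Set (Pt S)} {p q r : Pt S} {a : ℝ}

/-- The properties of a slimmed section in `(Q_μ^{slim})^+` that make it a retract of the tight
span. Up to translation outside its zero set, a point of the tight span lies on `R` unless it is a
down-fat with a down-free node or the mirror image of one. -/
structure IsCore (μ : S → S → ℝ) (R : Set (Pt S)) : Prop where
  subset : R ⊆ tightSpan μ
  not_downFree : ∀ p ∈ R, DownFat μ p → ¬ DownFree μ p
  not_upFree : ∀ p ∈ R, UpFat μ p → ¬ UpFree μ p
  trichotomy : ∀ p ∈ tightSpan μ,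
    DownFat μ p ∧ DownFree μ p ∨ UpFat μ p ∧ UpFree μ p ∨ ∃ a, shift p a ∈ R
  antichain : ∀ p ∈ R, ∀ q ∈ R, DownFat μ p ∨ UpFat μ p → DownFat μ q ∨ UpFat μ q →
    zeroSet p = zeroSet q → zeroSet q ≠ univ →
      ¬ ((∀ s ∉ zeroSet q, p (inl s) < q (inl s)) ∨ ∀ s ∉ zeroSet q, p (inr s) < q (inr s))

/-- The points of the tight span lying above the core `R`, from where the downward flow
reaches `R`. -/
def descentSet (μ : S → S → ℝ) (R : Set (Pt S)) : Set (Pt S) :=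
  {p | p ∈ tightSpan μ ∧ zeroSet p ≠ univ ∧ DownFat μ p ∧ ∀ a, 0 ≤ a → shift p a ∉ R}

/-- The mirror image of `descentSet`. -/
def ascentSet (μ : S → S → ℝ) (R : Set (Pt S)) : Set (Pt S) :=
  swapPt ⁻¹' descentSet (tr μ) (swapPt ⁻¹' R)

theorem disjoint_descentSet (μ : S → S → ℝ) (R : Set (Pt S)) : Disjoint R (descentSet μ R) :=
  disjoint_left.2 fun p hp hD => hD.2.2.2 0 le_rfl (by rwa [shift_zero])

theorem exists_lt_of_shift_neg_mem (hp : p ∈ nonnegPart (P μ)) (ha : 0 < a)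
    (hmem : shift p (-a) ∈ R) :
    ∃ r ∈ R, UpFat μ r ∧ zeroSet r = zeroSet p ∧ ∀ s ∉ zeroSet p, r (inl s) < p (inl s) := by
  refine ⟨_, hmem, upFat_shift hp (neg_neg_of_pos ha), zeroSet_shift hp.2 _, fun s hs => ?_⟩
  rw [shift_inl_of_notMem hs]
  linarith

namespace IsCore

theorem swap (hR : IsCore μ R) : IsCore (tr μ) (swapPt ⁻¹' R) where
  subset p hp := by simpa using swapPt_mem_tightSpan.2 (hR.subset hp)
  not_downFree p hp := by simpa only [UpFat, UpFree, swapPt_swapPt] using hR.not_upFree _ hp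
  not_upFree p hp := hR.not_downFree _ hp
  trichotomy p hp := by
    have hp' : swapPt p ∈ tightSpan μ := swapPt_mem_tightSpan.2 hp
    rcases hR.trichotomy _ hp' with h | h | ⟨a, ha⟩
    · exact Or.inr (Or.inl h)
    · exact Or.inl (by simpa only [UpFat, UpFree, swapPt_swapPt] using h)
    · refine Or.inr (Or.inr ⟨-a, ?_⟩)
      rwa [mem_preimage, swapPt_shift, neg_neg]
  antichain p hp q hq hfp hfq hpq hne := by
    have hswap {r : Pt S} (hr : DownFat (tr μ) r ∨ UpFat (tr μ) r) :
        DownFat μ (swapPt r) ∨ UpFat μ (swapPt r) := by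
      rw [UpFat, swapPt_swapPt]
      exact hr.symm
    have := hR.antichain _ hp _ hq (hswap hfp) (hswap hfq) (by simpa using hpq) (by simpa using hne)
    simpa [or_comm] using this

theorem mem_descentSet_of_downFree (hR : IsCore μ R) (hp : p ∈ tightSpan μ) (hfat : DownFat μ p)
    (hfree : DownFree μ p) : p ∈ descentSet μ R := by
  refine ⟨hp, fun h => ?_, hfat, fun a ha hmem => ?_⟩
  · obtain ⟨v, hv, -⟩ := hfree
    exact hv (h ▸ mem_univ v)
  · refine hR.not_downFree _ hmem ?_ ((downFree_shift hp.1.2 a).2 hfree)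
    rcases ha.eq_or_lt with rfl | ha
    · rwa [shift_zero]
    · exact downFat_shift hp.1 ha

theorem mem_descentSet_of_lt (hR : IsCore μ R) (hq : q ∈ tightSpan μ) (hfat : DownFat μ q)
    (hne : zeroSet q ≠ univ) (hr : r ∈ R) (hfr : UpFat μ r) (hqr : zeroSet r = zeroSet q)
    (hlt : ∀ s ∉ zeroSet q, r (inl s) < q (inl s)) : q ∈ descentSet μ R := by
  refine ⟨hq, hne, hfat, fun a ha hmem => ?_⟩
  have hz := zeroSet_shift hq.1.2 a
  have hfat' : DownFat μ (shift q a) := by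
    rcases ha.eq_or_lt with rfl | ha
    · rwa [shift_zero]
    · exact downFat_shift hq.1 ha
  refine hR.antichain r hr _ hmem (.inr hfr) (.inl hfat') (hqr.trans hz.symm) (hz ▸ hne)
    (.inl fun s hs => ?_)
  rw [hz] at hs
  rw [shift_inl_of_notMem hs]
  linarith [hlt s hs]

theorem mem_descentSet_of_shift_neg_mem (hR : IsCore μ R) (hp : p ∈ tightSpan μ)
    (hne : zeroSet p ≠ univ) (ha : 0 < a) (hmem : shift p (-a) ∈ R) : p ∈ descentSet μ R := by
  have hz := zeroSet_shift hp.1.2 (-a)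
  have hfat : DownFat μ p := by
    have := downFat_shift (hR.subset hmem).1 ha
    rwa [shift_shift hp.1.2, neg_add_cancel, shift_zero] at this
  refine hR.mem_descentSet_of_lt hp hfat hne hmem (upFat_shift hp.1 (neg_neg_of_pos ha)) hz
    fun s hs => ?_
  rw [shift_inl_of_notMem hs]
  linarith

theorem mem_descentSet_or_mem_ascentSet_or_mem (hR : IsCore μ R) (hp : p ∈ tightSpan μ) :
    p ∈ descentSet μ R ∨ p ∈ ascentSet μ R ∨ p ∈ R := by
  have hp' := swapPt_mem_tightSpan.2 hp
  rcases hR.trichotomy p hp with h | h | ⟨a, ha⟩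
  · exact Or.inl (hR.mem_descentSet_of_downFree hp h.1 h.2)
  · exact Or.inr (Or.inl (hR.swap.mem_descentSet_of_downFree hp' h.1 h.2))
  · by_cases hne : zeroSet p = univ
    · rw [shift_eq_self_of_zeroSet_eq_univ hne] at ha
      exact Or.inr (Or.inr ha)
    rcases lt_trichotomy a 0 with hneg | rfl | hpos
    · exact Or.inl (hR.mem_descentSet_of_shift_neg_mem hp hne (neg_pos.2 hneg) (by rwa [neg_neg]))
    · exact Or.inr (Or.inr (by rwa [shift_zero] at ha))
    · refine Or.inr (Or.inl (hR.swap.mem_descentSet_of_shift_neg_mem hp' (by simpa) hpos ?_))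
      rwa [← swapPt_shift, mem_preimage, swapPt_swapPt]

theorem diff_descentSet_diff_ascentSet (hR : IsCore μ R) :
    (tightSpan μ \ descentSet μ R) \ ascentSet μ R = R := by
  ext p
  constructor
  · rintro ⟨⟨hp, hD⟩, hU⟩
    exact ((hR.mem_descentSet_or_mem_ascentSet_or_mem hp).resolve_left hD).resolve_left hU
  · intro hp
    exact ⟨⟨hR.subset hp, disjoint_left.1 (disjoint_descentSet μ R) hp⟩,
      disjoint_left.1 (disjoint_descentSet _ _) (by simpa using hp)⟩

section Finite

variable [Finite S]

theorem downFree_or_shift_neg_mem (hR : IsCore μ R) (hp : p ∈ descentSet μ R) :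
    DownFree μ p ∨ ∃ a > 0, shift p (-a) ∈ R := by
  obtain ⟨hT, -, hfat, hR'⟩ := hp
  rcases hR.trichotomy p hT with h | h | ⟨a, ha⟩
  · exact Or.inl h.2
  · exact absurd h.2 (hfat.not_upFree hT)
  · refine Or.inr ⟨-a, neg_pos.2 (lt_of_not_ge fun h => hR' a h ha), by rwa [neg_neg]⟩

theorem disjoint_descentSet_ascentSet (hR : IsCore μ R) :
    Disjoint (descentSet μ R) (ascentSet μ R) := by
  refine disjoint_left.2 fun p hD hU => ?_
  have hfree : ¬ DownFree μ p := UpFat.not_downFree hU.2.2.1 hD.1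
  obtain ⟨a, ha, hmem⟩ := (hR.downFree_or_shift_neg_mem hD).resolve_left hfree
  refine hU.2.2.2 a ha.le ?_
  rwa [mem_preimage, ← neg_neg a, ← swapPt_shift, swapPt_swapPt]

theorem mem_descentSet_of_downFatOn (hR : IsCore μ R) (hp : p ∈ P μ) (hq : q ∈ tightSpan μ)
    (hne : zeroSet p ≠ univ) (hfat : DownFatOn μ (zeroSet p) q)
    (hcompare : zeroSet q = zeroSet p → DownFree μ q ∨
      ∃ r ∈ R, UpFat μ r ∧ zeroSet r = zeroSet p ∧ ∀ s ∉ zeroSet p, r (inl s) < q (inl s)) :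
    q ∈ descentSet μ R := by
  have hfatq := hfat.downFat hp hq
  by_cases hz : zeroSet q = zeroSet p
  · rcases hcompare hz with hfree | ⟨r, hr, hfr, hrz, hlt⟩
    · exact hR.mem_descentSet_of_downFree hq hfatq hfree
    · exact hR.mem_descentSet_of_lt hq hfatq (hz ▸ hne) hr hfr (hrz.trans hz.symm) (hz ▸ hlt)
  · exact hR.mem_descentSet_of_downFree hq hfatq (hfat.downFree hp hq hz)

theorem upper_descentSet (hR : IsCore μ R) (hp : p ∈ descentSet μ R) (hq : q ∈ tightSpan μ)
    (hle : ∀ s, p (inl s) ≤ q (inl s)) : q ∈ descentSet μ R := by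
  have ⟨hT, hne, hfat, _⟩ := hp
  refine hR.mem_descentSet_of_downFatOn hT.1.1 hq hne (fun u hu => ?_) fun hz => ?_
  · exact ⟨(hfat u hu).1.trans_le (hle u), fun s hs => ((hfat u hu).2 s hs).trans_le (hle u)⟩
  rcases hR.downFree_or_shift_neg_mem hp with ⟨v, hv, hfree⟩ | ⟨a, ha, hmem⟩
  · have hvle : p (inr v) ≤ q (inr v) := by
      rcases inr_eq_zero_or hT v with h | ⟨u, hu⟩
      · exact h ▸ nonneg_of_mem_tightSpan hq _
      · have huZ : u ∈ zeroSet p := by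
          by_contra huZ
          exact (hfree u huZ).ne' hu
        have huq : u ∈ zeroSet q := hz ▸ huZ
        linarith [le_of_mem_tightSpan hq u v, huZ.1, huq.1]
    refine Or.inl ⟨v, hz ▸ hv, fun u hu => (hfree u (hz ▸ hu)).trans_le (add_le_add (hle u) hvle)⟩
  · obtain ⟨r, hr, hfr, hrz, hlt⟩ := exists_lt_of_shift_neg_mem hT.1 ha hmem
    exact Or.inr ⟨r, hr, hfr, hrz, fun s hs => (hlt s hs).trans_le (hle s)⟩

theorem descentSet_mem_nhdsWithin (hR : IsCore μ R) (hp : p ∈ descentSet μ R) :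
    descentSet μ R ∈ 𝓝[tightSpan μ] p := by
  have ⟨hT, hne, hfat, _⟩ := hp
  have hcont (u : S ⊕ S) : ContinuousAt (fun q : Pt S => q u) p := continuousAt_apply _ _
  have hfatOn : ∀ᶠ q in 𝓝 p, DownFatOn μ (zeroSet p) q := by
    refine eventually_all.2 fun u => eventually_imp_distrib_left.2 fun hu => ?_
    refine ((hcont _).eventually_const_lt (hfat u hu).1).and ?_
    exact eventually_all.2 fun s => eventually_imp_distrib_left.2 fun hs =>
      (hcont _).eventually_const_lt ((hfat u hu).2 s hs)
  have hcompare : ∀ᶠ q in 𝓝 p, zeroSet q = zeroSet p → DownFree μ q ∨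
      ∃ r ∈ R, UpFat μ r ∧ zeroSet r = zeroSet p ∧ ∀ s ∉ zeroSet p, r (inl s) < q (inl s) := by
    rcases hR.downFree_or_shift_neg_mem hp with ⟨v, hv, hfree⟩ | ⟨a, ha, hmem⟩
    · have hnear : ∀ᶠ q in 𝓝 p, ∀ u, u ∉ zeroSet p → μ u v < q (inl u) + q (inr v) :=
        eventually_all.2 fun u => eventually_imp_distrib_left.2 fun hu =>
          ((hcont _).add (hcont _)).eventually_const_lt (hfree u hu)
      filter_upwards [hnear] with q hq hz
      exact Or.inl ⟨v, hz ▸ hv, fun u hu => hq u (hz ▸ hu)⟩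
    · obtain ⟨r, hr, hfr, hrz, hlt⟩ := exists_lt_of_shift_neg_mem hT.1 ha hmem
      have hnear : ∀ᶠ q in 𝓝 p, ∀ s, s ∉ zeroSet p → r (inl s) < q (inl s) :=
        eventually_all.2 fun s => eventually_imp_distrib_left.2 fun hs =>
          (hcont _).eventually_const_lt (hlt s hs)
      filter_upwards [hnear] with q hq _
      exact Or.inr ⟨r, hr, hfr, hrz, hq⟩
  filter_upwards [nhdsWithin_le_nhds hfatOn, nhdsWithin_le_nhds hcompare, self_mem_nhdsWithin]
    with q hq hq' hqT
  exact hR.mem_descentSet_of_downFatOn hT.1.1 hqT hne hq hq'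

theorem isFlowDomain_descentSet (hR : IsCore μ R) : IsFlowDomain μ (descentSet μ R) where
  subset _ hp := hp.1
  upper _ hp _ hq hle := hR.upper_descentSet hp hq hle
  mem_nhdsWithin _ hp := hR.descentSet_mem_nhdsWithin hp
  exists_pos p hp := by
    obtain ⟨s, hs⟩ := (ne_univ_iff_exists_notMem _).1 hp.2.1
    exact ⟨s, (hp.2.2.1 s hs).1⟩
  zeroSet_anti p hp q _ hle s hs := by
    by_contra h
    linarith [(hp.2.2.1 s h).1, hle s, hs.1]

end Finite

theorem exists_isRetraction [Fintype S] (hR : IsCore μ R) :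
    ∃ f ι, IsRetraction (tightSpan μ) R f ι := by
  have hU : IsFlowDomain (tr μ) (swapPt ⁻¹' ascentSet μ R) := by
    rw [ascentSet, preimage_swapPt_preimage_swapPt]
    exact hR.swap.isFlowDomain_descentSet
  have := hR.isFlowDomain_descentSet.exists_isRetraction_diff hU hR.disjoint_descentSet_ascentSet
  rwa [hR.diff_descentSet_diff_ascentSet] at this

end IsCore

end Core

section Graph

variable {S : Type*} {μ : S → S → ℝ} {p r : Pt S} {X Y : Set S} {R : Set (Pt S)}

theorem K_adj_inl_inr {s t : S} :
    (K μ p).Adj (inl s) (inr t) ↔ p (inl s) + p (inr t) = μ s t := by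
  simp [K, SimpleGraph.fromRel_adj]

theorem inr_mem_N_inl_iff {v : S} :
    inr v ∈ N μ p (inl '' Y) ↔ ∃ u ∈ Y, p (inl u) + p (inr v) = μ u v := by
  simp [N, K_adj_inl_inr]

theorem N_inl_subset_range_inr : N μ p (inl '' Y) ⊆ range inr := by
  rintro (v | v) ⟨-, u, ⟨s, -, rfl⟩, hadj⟩
  · simp [K, SimpleGraph.fromRel_adj] at hadj
  · exact mem_range_self v

theorem N_swapPt : N (tr μ) (swapPt p) (inl '' Y) = Sum.swap ⁻¹' N μ p (inr '' Y) := by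
  ext (v | v) <;> simp [N, K, SimpleGraph.fromRel_adj, add_comm]

theorem preimage_swap_image_inl : Sum.swap ⁻¹' (inl '' Y) = (inr '' Y : Set (S ⊕ S)) := by
  ext (s | s) <;> simp

theorem swapPt_mem_Q (hp : p ∈ Q μ) : swapPt p ∈ Q (tr μ) :=
  minimal_swapPt (fun _ => swapPt_mem_P) hp

theorem mem_Q_of_exists_edge (hp : p ∈ P μ)
    (hinl : ∀ s, ∃ t, p (inl s) + p (inr t) = μ s t)
    (hinr : ∀ t, ∃ s, p (inl s) + p (inr t) = μ s t) : p ∈ Q μ := by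
  refine ⟨hp, fun y hy hle => ?_⟩
  rintro (s | t)
  · obtain ⟨t, ht⟩ := hinl s
    linarith [hy s t, hle (inr t)]
  · obtain ⟨s, hs⟩ := hinr t
    linarith [hy s t, hle (inl s)]

theorem isNull_zeroSet (hμ : IsDirectedDistance μ) (hp : p ∈ P μ) : IsNull μ (zeroSet p) :=
  fun _ hs _ ht => (le_zero_of_mem_zeroSet hp hs ht).antisymm (hμ.nonneg _ _)

theorem mem_QX_iff (hμ : IsDirectedDistance μ) (hp : p ∈ nonnegPart (Q μ)) :
    p ∈ QX μ X ↔ X = zeroSet p := by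
  simp only [QX, mem_ofPred_eq, hp.1, true_and, K_adj_inl_inr, hμ.diag,
    ← mem_zeroSet_iff_add_eq_zero hp.2]
  exact ⟨fun h => Set.ext fun s => (h s).symm, fun h s => h ▸ Iff.rfl⟩

theorem mem_Qslim_iff (hμ : IsDirectedDistance μ) (hp : p ∈ nonnegPart (Q μ)) :
    p ∈ Qslim μ ↔ (IsFatRel μ (zeroSet p) p → p ∈ Qdeg μ (zeroSet p)) := by
  have hnull := isNull_zeroSet hμ hp.1.1
  have hfat : (∃ X, IsNull μ X ∧ IsFatRel μ X p) ↔ IsFatRel μ (zeroSet p) p :=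
    ⟨fun ⟨X, _, hX⟩ => (mem_QX_iff hμ hp).1 hX.1 ▸ hX, fun h => ⟨_, hnull, h⟩⟩
  have hdeg : (∃ X, IsNull μ X ∧ p ∈ Qdeg μ X) ↔ p ∈ Qdeg μ (zeroSet p) :=
    ⟨fun ⟨X, _, hX⟩ => (mem_QX_iff hμ hp).1 hX.1 ▸ hX, fun h => ⟨_, hnull, h⟩⟩
  simp only [Qslim, IsProperFat, mem_ofPred_eq, hp.1, true_and, hfat, hdeg, not_and, not_not]

theorem N_inl_subset_iff (hμ : IsDirectedDistance μ) (hp : p ∈ P μ) (hne : (zeroSet p).Nonempty) :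
    N μ p (inl '' (zeroSet p)ᶜ) ⊆ inr '' (zeroSet p)ᶜ ↔ DownFat μ p := by
  constructor
  · intro h
    have hlt (u : S) (hu : u ∉ zeroSet p) (s : S) (hs : s ∈ zeroSet p) : μ u s < p (inl u) := by
      have hle := hp u s
      rw [hs.2, add_zero] at hle
      refine hle.lt_of_ne' fun heq => ?_
      have hN : inr s ∈ N μ p (inl '' (zeroSet p)ᶜ) :=
        inr_mem_N_inl_iff.2 ⟨u, hu, by rw [hs.2, add_zero, heq]⟩
      exact (Sum.inr_injective.mem_set_image.1 (h hN)) hs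
    obtain ⟨s, hs⟩ := hne
    exact fun u hu => ⟨(hμ.nonneg u s).trans_lt (hlt u hu s hs), hlt u hu⟩
  · intro hfat v hv
    obtain ⟨v, rfl⟩ := N_inl_subset_range_inr hv
    obtain ⟨u, hu, hedge⟩ := inr_mem_N_inl_iff.1 hv
    refine mem_image_of_mem _ fun hvZ => ?_
    linarith [(hfat u hu).2 v hvZ, hvZ.2]

theorem image_inr_subset_N_inl_iff (hp : p ∈ P μ) :
    inr '' (zeroSet p)ᶜ ⊆ N μ p (inl '' (zeroSet p)ᶜ) ↔ ¬ DownFree μ p := by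
  simp only [image_subset_iff, DownFree, not_exists, not_and, not_forall, not_lt]
  refine forall₂_congr fun v _ => inr_mem_N_inl_iff.trans ?_
  exact exists_congr fun u => by
    rw [mem_compl_iff, exists_prop, and_congr_right_iff]
    exact fun _ => ⟨fun h => h.le, fun h => h.antisymm (hp u v)⟩

theorem N_inr_subset_iff (hμ : IsDirectedDistance μ) (hp : p ∈ P μ) (hne : (zeroSet p).Nonempty) :
    N μ p (inr '' (zeroSet p)ᶜ) ⊆ inl '' (zeroSet p)ᶜ ↔ UpFat μ p := by
  rw [← Sum.swap_rightInverse.surjective.preimage_subset_preimage_iff, ← N_swapPt,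
    preimage_swap_image_inl]
  simpa only [zeroSet_swapPt] using N_inl_subset_iff hμ.swap (swapPt_mem_P.2 hp) (by simpa)

theorem image_inl_subset_N_inr_iff (hp : p ∈ P μ) :
    inl '' (zeroSet p)ᶜ ⊆ N μ p (inr '' (zeroSet p)ᶜ) ↔ ¬ UpFree μ p := by
  rw [← Sum.swap_rightInverse.surjective.preimage_subset_preimage_iff, ← N_swapPt,
    preimage_swap_image_inl]
  simpa only [zeroSet_swapPt] using image_inr_subset_N_inl_iff (swapPt_mem_P.2 hp)

theorem isFatRel_zeroSet_iff (hμ : IsDirectedDistance μ) (hp : p ∈ nonnegPart (Q μ))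
    (hne : (zeroSet p).Nonempty) : IsFatRel μ (zeroSet p) p ↔ DownFat μ p ∨ UpFat μ p := by
  rw [IsFatRel, and_iff_right ((mem_QX_iff hμ hp).2 rfl), N_inl_subset_iff hμ hp.1.1 hne,
    N_inr_subset_iff hμ hp.1.1 hne]

theorem mem_Qdeg_zeroSet_iff (hμ : IsDirectedDistance μ) (hp : p ∈ nonnegPart (Q μ))
    (hne : (zeroSet p).Nonempty) : p ∈ Qdeg μ (zeroSet p) ↔
      DownFat μ p ∧ ¬ DownFree μ p ∨ UpFat μ p ∧ ¬ UpFree μ p := by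
  simp only [Qdeg, mem_ofPred_eq, (mem_QX_iff hμ hp).2 rfl, true_and, subset_antisymm_iff,
    N_inl_subset_iff hμ hp.1.1 hne, N_inr_subset_iff hμ hp.1.1 hne,
    image_inr_subset_N_inl_iff hp.1.1, image_inl_subset_N_inr_iff hp.1.1]

theorem exists_eq_shift_of_slimRel (hμ : IsDirectedDistance μ) (hp : p ∈ nonnegPart (Q μ))
    (hr : ∀ u, 0 ≤ r u) (h : SlimRel μ p r) : ∃ a, r = shift p a := by
  obtain ⟨a, b, hab⟩ : ∃ a b : ℝ, a • dirVec univ + b • dirVec (zeroSet p) = p - r := by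
    rcases h with h | ⟨X, -, hpX, -, h⟩
    · obtain ⟨a, ha⟩ := Submodule.mem_span_singleton.1 h
      exact ⟨a, 0, by rw [ha, zero_smul, add_zero]⟩
    · rw [(mem_QX_iff hμ hp).1 hpX.1, diagLine, ← Submodule.span_union, singleton_union] at h
      exact Submodule.mem_span_pair.1 h
  refine ⟨-a, ?_⟩
  have hcoord (s : S) (hs : s ∉ zeroSet p) :
      r (inl s) = p (inl s) - a ∧ r (inr s) = p (inr s) + a := by
    have hinl := congrFun hab (inl s)
    have hinr := congrFun hab (inr s)
    simp only [dirVec, indicator_univ, Pi.add_apply, Pi.smul_apply, Pi.sub_apply, Sum.elim_inl,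
      Sum.elim_inr, smul_eq_mul, indicator_of_notMem hs] at hinl hinr
    constructor <;> linarith
  have hzero (s : S) (hs : s ∈ zeroSet p) : r (inl s) = p (inl s) ∧ r (inr s) = p (inr s) := by
    have hinl := congrFun hab (inl s)
    have hinr := congrFun hab (inr s)
    simp only [dirVec, indicator_univ, Pi.add_apply, Pi.smul_apply, Pi.sub_apply, Sum.elim_inl,
      Sum.elim_inr, smul_eq_mul, indicator_of_mem hs] at hinl hinr
    constructor <;> linarith [hr (inl s), hr (inr s), hs.1, hs.2]
  ext (s | s) <;> by_cases hs : s ∈ zeroSet p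
  · rw [shift_inl_of_mem hs, (hzero s hs).1]
  · rw [shift_inl_of_notMem hs, (hcoord s hs).1, sub_eq_add_neg]
  · rw [shift_inr_of_mem hs, (hzero s hs).2]
  · rw [shift_inr_of_notMem hs, (hcoord s hs).2, sub_neg_eq_add]

theorem IsSection.exists_slimRel (hR : IsSection μ R) (hp : p ∈ Qslim μ) :
    ∃ r ∈ R, SlimRel μ p r := by
  obtain ⟨r, hr⟩ := hR.bijective.2 (Quotient.mk (slimSetoid μ) ⟨p, hp⟩)
  exact ⟨r, r.2, (slimRel_equivalence μ).symm (Quotient.exact hr)⟩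

variable [Finite S]

theorem exists_inl_edge_of_mem_Q (hp : p ∈ Q μ) (u : S) :
    ∃ t, p (inl u) + p (inr t) = μ u t := by
  classical
  by_contra! hedge
  have : Nonempty S := ⟨u⟩
  obtain ⟨t₀, ht₀⟩ := Finite.exists_min fun t => p (inl u) + p (inr t) - μ u t
  set ε := p (inl u) + p (inr t₀) - μ u t₀
  have hε : 0 < ε := sub_pos.2 ((hp.1 u t₀).lt_of_ne' (hedge t₀))
  have hP : Function.update p (inl u) (p (inl u) - ε) ∈ P μ := fun s t => by
    rw [Function.update_of_ne (by simp : (inr t : S ⊕ S) ≠ inl u)]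
    rcases eq_or_ne s u with rfl | hs
    · rw [Function.update_self]
      linarith [ht₀ t]
    · rw [Function.update_of_ne (by simpa using hs)]
      exact hp.1 s t
  have hmin := hp.2 hP (update_le_self_iff.2 (by linarith)) (inl u)
  rw [Function.update_self] at hmin
  linarith

theorem exists_inr_edge_of_mem_Q (hp : p ∈ Q μ) (v : S) :
    ∃ s, p (inl s) + p (inr v) = μ s v := by
  simpa [add_comm] using exists_inl_edge_of_mem_Q (swapPt_mem_Q hp) v

theorem not_downFree_of_zeroSet_eq_empty (hp : p ∈ Q μ) (hp₀ : zeroSet p = ∅) :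
    ¬ DownFree μ p := by
  rintro ⟨v, -, hfree⟩
  obtain ⟨u, hu⟩ := exists_inr_edge_of_mem_Q hp v
  exact (hfree u (hp₀ ▸ notMem_empty u)).ne' hu

theorem mem_Qdeg_of_zeroSet_eq_empty (hμ : IsDirectedDistance μ) (hp : p ∈ nonnegPart (Q μ))
    (hp₀ : zeroSet p = ∅) : p ∈ Qdeg μ (zeroSet p) := by
  refine ⟨(mem_QX_iff hμ hp).2 rfl, Or.inl (Subset.antisymm ?_ ?_)⟩
  · simpa [hp₀] using N_inl_subset_range_inr (μ := μ) (p := p) (Y := univ)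
  · exact (image_inr_subset_N_inl_iff hp.1.1).2 (not_downFree_of_zeroSet_eq_empty hp.1 hp₀)

theorem mem_Qdeg_of_fat (hμ : IsDirectedDistance μ) (hp : p ∈ nonnegPart (Q μ)) (hps : p ∈ Qslim μ)
    (hfat : DownFat μ p ∨ UpFat μ p) : p ∈ Qdeg μ (zeroSet p) := by
  rcases (zeroSet p).eq_empty_or_nonempty with hp₀ | hne
  · exact mem_Qdeg_of_zeroSet_eq_empty hμ hp hp₀
  · exact (mem_Qslim_iff hμ hp).1 hps ((isFatRel_zeroSet_iff hμ hp hne).2 hfat)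

end Graph

section Slim

variable {S : Type*} [Finite S] {μ : S → S → ℝ} {p : Pt S} {R : Set (Pt S)}

theorem not_free_of_mem_Qdeg (hμ : IsDirectedDistance μ) (hp : p ∈ nonnegPart (Q μ))
    (hdeg : p ∈ Qdeg μ (zeroSet p)) : ¬ DownFree μ p ∧ ¬ UpFree μ p := by
  have hT := nonnegPart_Q_subset_tightSpan hp
  rcases (zeroSet p).eq_empty_or_nonempty with hp₀ | hne
  · exact ⟨not_downFree_of_zeroSet_eq_empty hp.1 hp₀,
      not_downFree_of_zeroSet_eq_empty (swapPt_mem_Q hp.1) (by simpa)⟩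
  · rcases (mem_Qdeg_zeroSet_iff hμ hp hne).1 hdeg with ⟨hfat, hfree⟩ | ⟨hfat, hfree⟩
    · exact ⟨hfree, hfat.not_upFree hT⟩
    · exact ⟨UpFat.not_downFree hfat hT, hfree⟩

theorem fat_and_free_of_notMem_Qslim (hμ : IsDirectedDistance μ) (hp : p ∈ nonnegPart (Q μ))
    (hps : p ∉ Qslim μ) : DownFat μ p ∧ DownFree μ p ∨ UpFat μ p ∧ UpFree μ p := by
  rw [mem_Qslim_iff hμ hp, Classical.not_imp] at hps
  obtain ⟨hfat, hdeg⟩ := hps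
  rcases (zeroSet p).eq_empty_or_nonempty with hp₀ | hne
  · exact absurd (mem_Qdeg_of_zeroSet_eq_empty hμ hp hp₀) hdeg
  rw [isFatRel_zeroSet_iff hμ hp hne] at hfat
  rw [mem_Qdeg_zeroSet_iff hμ hp hne] at hdeg
  tauto

theorem downFat_and_downFree_of_isolated (hμ : IsDirectedDistance μ) (hp : p ∈ tightSpan μ) {v : S}
    (hv : ∀ u, p (inl u) + p (inr v) ≠ μ u v) : DownFat μ p ∧ DownFree μ p := by
  have hv₀ : p (inr v) = 0 := (inr_eq_zero_or hp v).resolve_right fun ⟨u, hu⟩ => hv u hu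
  have hlt (u : S) : μ u v < p (inl u) + p (inr v) :=
    (le_of_mem_tightSpan hp u v).lt_of_ne' (hv u)
  have hpos (u : S) : 0 < p (inl u) := by linarith [hlt u, hμ.nonneg u v]
  have hempty (s : S) : s ∉ zeroSet p := fun hs => (hpos s).ne' hs.1
  exact ⟨fun u _ => ⟨hpos u, fun s hs => absurd hs (hempty s)⟩, v, hempty v, fun u _ => hlt u⟩

theorem fat_and_free_of_notMem_Q (hμ : IsDirectedDistance μ) (hp : p ∈ tightSpan μ)
    (hpQ : p ∉ Q μ) : DownFat μ p ∧ DownFree μ p ∨ UpFat μ p ∧ UpFree μ p := by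
  by_cases hinr : ∀ v, ∃ u, p (inl u) + p (inr v) = μ u v
  · have hinl : ¬ ∀ u, ∃ v, p (inl u) + p (inr v) = μ u v := fun hinl =>
      hpQ (mem_Q_of_exists_edge hp.1.1 hinl hinr)
    push Not at hinl
    obtain ⟨u, hu⟩ := hinl
    refine Or.inr (downFat_and_downFree_of_isolated hμ.swap (swapPt_mem_tightSpan.2 hp) (v := u) ?_)
    exact fun v hv => hu v (by simpa [add_comm] using hv)
  · push Not at hinr
    obtain ⟨v, hv⟩ := hinr
    exact Or.inl (downFat_and_downFree_of_isolated hμ hp hv)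

theorem IsSlimmedSectionPos.isCore (hμ : IsDirectedDistance μ) (hR : IsSlimmedSectionPos μ R) :
    IsCore μ R := by
  have hQ {p : Pt S} (hp : p ∈ R) : p ∈ nonnegPart (Q μ) :=
    ⟨(hR.subset_nonneg hp).1.1, (hR.subset_nonneg hp).2⟩
  have hdeg {p : Pt S} (hp : p ∈ R) (hfat : DownFat μ p ∨ UpFat μ p) : p ∈ Qdeg μ (zeroSet p) :=
    mem_Qdeg_of_fat hμ (hQ hp) (hR.subset_nonneg hp).1 hfat
  refine ⟨fun p hp => nonnegPart_Q_subset_tightSpan (hQ hp), fun p hp hfat => ?_,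
    fun p hp hfat => ?_, fun p hp => ?_, fun p hp q hq hfp hfq hpq hne hlt => ?_⟩
  · exact (not_free_of_mem_Qdeg hμ (hQ hp) (hdeg hp (.inl hfat))).1
  · exact (not_free_of_mem_Qdeg hμ (hQ hp) (hdeg hp (.inr hfat))).2
  · rw [← or_assoc, or_iff_not_imp_left]
    intro hfree
    have hpQ : p ∈ nonnegPart (Q μ) :=
      ⟨of_not_not fun h => hfree (fat_and_free_of_notMem_Q hμ hp h), nonneg_of_mem_tightSpan hp⟩
    have hps : p ∈ Qslim μ := of_not_not fun h => hfree (fat_and_free_of_notMem_Qslim hμ hpQ h)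
    obtain ⟨r, hr, hpr⟩ := hR.isSection.exists_slimRel hps
    obtain ⟨a, rfl⟩ := exists_eq_shift_of_slimRel hμ hpQ (hR.subset_nonneg hr).2 hpr
    exact ⟨a, hr⟩
  · refine hR.deg_balanced _ (isNull_zeroSet hμ (hQ hq).1.1) hne ⟨p, ⟨hp, ?_⟩, q, ⟨hq, ?_⟩, hlt⟩
    · exact ⟨hpq ▸ hdeg hp hfp, (hQ hp).2⟩
    · exact ⟨hdeg hq hfq, (hQ hq).2⟩

end Slim

section Translation

variable {S : Type*} {μ : S → S → ℝ} {R R' : Set (Pt S)} {p q p' q' : Pt S}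

theorem exists_sub_mem_of_mkQ_image_eq (h : (diagLine S).mkQ '' R = (diagLine S).mkQ '' R')
    (hp : p ∈ R) : ∃ p' ∈ R', p' - p ∈ diagLine S := by
  obtain ⟨p', hp', heq⟩ := h ▸ mem_image_of_mem (diagLine S).mkQ hp
  exact ⟨p', hp', (Submodule.Quotient.eq _).1 heq⟩

theorem IsBalanced.eq_of_sub_mem (hR : IsBalanced R) (hp : p ∈ R) (hq : q ∈ R)
    (h : p - q ∈ diagLine S) : p = q := by
  obtain ⟨a, hinl, hinr⟩ := mem_diagLine.1 h
  simp only [Pi.sub_apply] at hinl hinr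
  rcases lt_trichotomy a 0 with ha | rfl | ha
  · exact absurd ⟨p, hp, q, hq, Or.inl fun s => by linarith [hinl s]⟩ hR
  · ext (s | s)
    · linarith [hinl s]
    · linarith [hinr s]
  · exact absurd ⟨q, hq, p, hp, Or.inl fun s => by linarith [hinl s]⟩ hR

variable [Fintype S]

theorem IsBalanced.dInf_le_add (hR : IsBalanced R) (hp : p ∈ R) (hq : q ∈ R) {a b : ℝ}
    (hpp : p - p' = a • dirVec univ) (hqq : q - q' = b • dirVec univ) :
    dInf p q ≤ dInf p' q' + (b - a) := by
  have hp_inl (s : S) : p (inl s) = p' (inl s) + a := by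
    simpa [dirVec, sub_eq_iff_eq_add'] using congrFun hpp (inl s)
  have hp_inr (s : S) : p (inr s) = p' (inr s) - a := by
    simpa [dirVec, sub_eq_iff_eq_add', ← sub_eq_add_neg] using congrFun hpp (inr s)
  have hq_inl (s : S) : q (inl s) = q' (inl s) + b := by
    simpa [dirVec, sub_eq_iff_eq_add'] using congrFun hqq (inl s)
  have hq_inr (s : S) : q (inr s) = q' (inr s) - b := by
    simpa [dirVec, sub_eq_iff_eq_add', ← sub_eq_add_neg] using congrFun hqq (inr s)
  refine dInf_le_iff.2 ⟨?_, fun s => ?_, fun s => ?_⟩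
  · by_contra! hneg
    exact hR ⟨q, hq, p, hp, Or.inl fun s => by
      linarith [inl_le_add_dInf p' q' s, hp_inl s, hq_inl s]⟩
  · linarith [inl_le_add_dInf p' q' s, hp_inl s, hq_inl s]
  · linarith [inr_le_add_dInf p' q' s, hp_inr s, hq_inr s]

theorem IsBalanced.dSym_le (hR : IsBalanced R) (hp : p ∈ R) (hq : q ∈ R)
    (hpp : p - p' ∈ diagLine S) (hqq : q - q' ∈ diagLine S) : dSym p q ≤ dSym p' q' := by
  obtain ⟨a, ha⟩ := Submodule.mem_span_singleton.1 hpp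
  obtain ⟨b, hb⟩ := Submodule.mem_span_singleton.1 hqq
  have hpq := hR.dInf_le_add hp hq ha.symm hb.symm
  have hqp := hR.dInf_le_add hq hp hb.symm ha.symm
  unfold dSym
  linarith

theorem IsBalanced.exists_isRetraction (hR : IsBalanced R) (hR' : IsBalanced R')
    (h : (diagLine S).mkQ '' R = (diagLine S).mkQ '' R') : ∃ f ι, IsRetraction R' R f ι := by
  choose! f hf hf' using fun p (hp : p ∈ R') => exists_sub_mem_of_mkQ_image_eq h.symm hp
  choose! ι hι hι' using fun p (hp : p ∈ R) => exists_sub_mem_of_mkQ_image_eq h hp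
  refine ⟨f, ι, hf, hι, fun p hp => ?_, ?_, ?_, ?_, ?_⟩
  · refine hR.eq_of_sub_mem (hf _ (hι p hp)) hp ?_
    simpa using add_mem (hf' _ (hι p hp)) (hι' p hp)
  · exact fun p hp q hq => hR.dSym_le (hf p hp) (hf q hq) (hf' p hp) (hf' q hq)
  · exact fun p hp q hq => hR'.dSym_le (hι p hp) (hι q hq) (hι' p hp) (hι' q hq)
  · exact fun p hp s hs => (sum_eq_of_sub_mem (hf' p hp) s s).trans hs
  · exact fun p hp s hs => (sum_eq_of_sub_mem (hι' p hp) s s).trans hs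

end Translation

section Terminals

variable {S : Type*} [Fintype S] {μ : S → S → ℝ} {R : Set (Pt S)} {p q : Pt S}

theorem IsSlimmedSection.exists_isRetraction (hμ : IsDirectedDistance μ)
    (hR : IsSlimmedSection μ R) : ∃ f ι, IsRetraction (nonnegPart (P μ)) R f ι := by
  obtain ⟨R', hR', himage⟩ := hR.exists_pos
  obtain ⟨f, ι, hf⟩ := (hR'.isCore hμ).exists_isRetraction
  obtain ⟨g, κ, hg⟩ := hR.balanced.exists_isRetraction hR'.balanced himage
  exact ⟨_, _, ((isRetraction_hull μ).trans hf).trans hg⟩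

theorem hull_mem_region {x : S → ℝ} {s : S} (hx : 0 ≤ x) (hxs : x s = 0) (h : ∀ u, μ u s ≤ x u) :
    hull μ x ∈ region (nonnegPart (P μ)) s := by
  have hT := hull_mem_tightSpan μ hx
  have hinl : hull μ x (inl s) ≤ 0 := hxs ▸ hull_inl_le hx s
  have hinr : hull μ x (inr s) ≤ 0 := dual_le_iff.2 ⟨le_rfl, by simpa using h⟩
  exact ⟨hT.1, (mem_zeroSet_iff_add_eq_zero hT.1.2).1
    ⟨hinl.antisymm (hT.1.2 _), hinr.antisymm (hT.1.2 _)⟩⟩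

theorem exists_mem_region_dSym_le (hμ : IsDirectedDistance μ) (s t : S) :
    ∃ p ∈ region (nonnegPart (P μ)) s, ∃ q ∈ region (nonnegPart (P μ)) t,
      dSym p q ≤ μ s t + μ t s := by
  -- The first bound puts `hull μ (x a b)` over `a`, the second within `μ a b` of `hull μ (x b a)`.
  let x (a b u : S) : ℝ := max (μ u a) (μ u b - μ a b)
  have hx (a b : S) : hull μ (x a b) ∈ region (nonnegPart (P μ)) a :=
    hull_mem_region (fun u => (hμ.nonneg u a).trans (le_max_left _ _)) (by simp [x, hμ.diag])
      fun u => le_max_left _ _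
  have hdist (a b : S) : dInf (hull μ (x a b)) (hull μ (x b a)) ≤ μ a b := by
    refine (dInf_hull_le μ _ _).trans (dPlus_le_iff.2 ⟨hμ.nonneg a b, fun u => max_le ?_ ?_⟩)
    · linarith [le_max_right (μ u a) (μ u b - μ a b)]
    · linarith [le_max_left (μ u a) (μ u b - μ a b), hμ.nonneg a b, hμ.nonneg b a]
  exact ⟨_, hx s t, _, hx t s, add_le_add (hdist s t) (hdist t s)⟩

theorem le_dInf_of_mem_region {s t : S} (hp : p ∈ region (nonnegPart (P μ)) s)
    (hq : q ∈ region (nonnegPart (P μ)) t) : μ s t ≤ dInf p q := by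
  have hps := (mem_zeroSet_iff_add_eq_zero hp.1.2).2 hp.2
  have hqt := (mem_zeroSet_iff_add_eq_zero hq.1.2).2 hq.2
  linarith [hp.1.1 s t, inr_le_add_dInf p q t, hps.1, hqt.2]

theorem isLeast_dInf_region {f ι : Pt S → Pt S} (hμ : IsDirectedDistance μ)
    (hf : IsRetraction (nonnegPart (P μ)) R f ι) (hR : R ⊆ nonnegPart (P μ)) (s t : S) :
    IsLeast {x : ℝ | ∃ p ∈ region R s, ∃ q ∈ region R t, x = dInf p q} (μ s t) := by
  have hle {a b : S} {p q : Pt S} (hp : p ∈ region R a) (hq : q ∈ region R b) : μ a b ≤ dInf p q :=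
    le_dInf_of_mem_region ⟨hR hp.1, hp.2⟩ ⟨hR hq.1, hq.2⟩
  constructor
  · obtain ⟨p, hp, q, hq, hpq⟩ := exists_mem_region_dSym_le hμ s t
    have hfp := (hf.region s).mapsTo hp
    have hfq := (hf.region t).mapsTo hq
    have hdSym : dInf (f p) (f q) + dInf (f q) (f p) ≤ μ s t + μ t s :=
      (hf.dSym_le p hp.1 q hq.1).trans hpq
    exact ⟨_, hfp, _, hfq, by linarith [hle hfp hfq, hle hfq hfp]⟩
  · rintro x ⟨p, hp, q, hq, rfl⟩
    exact hle hp hq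

end Terminals

end SlimTropical

theorem mainTheorem11 {S : Type*} [Fintype S] [Nonempty S] (μ : S → S → ℝ)
    (hμ : SlimTropical.IsDirectedDistance μ) (R : Set (SlimTropical.Pt S))
    (hR : SlimTropical.IsSlimmedSection μ R) :
    (ContractibleSpace R ∧ SlimTropical.IsGeodesic R ∧
      ∀ s : S, ContractibleSpace (SlimTropical.region R s) ∧
        SlimTropical.IsGeodesic (SlimTropical.region R s)) ∧
    (R ⊆ SlimTropical.nonnegPart (SlimTropical.Q μ) →
      ∀ s t : S, IsGLB {x : ℝ | ∃ p ∈ SlimTropical.region R s, ∃ q ∈ SlimTropical.region R t,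
        x = SlimTropical.dInf p q} (μ s t)) := by
  open SlimTropical in
  obtain ⟨f, ι, hf⟩ := hR.exists_isRetraction hμ
  have hregion (s : S) : (region (nonnegPart (P μ)) s).Nonempty := by
    obtain ⟨p, hp, -⟩ := exists_mem_region_dSym_le hμ s s
    exact ⟨p, hp⟩
  have hconvex := convex_nonnegPart_P μ
  have hne : (nonnegPart (P μ)).Nonempty := (hregion (Classical.arbitrary S)).mono fun _ => And.left
  refine ⟨⟨hf.contractibleSpace hconvex hne, hf.isGeodesic hconvex, fun s => ?_⟩, fun hRQ s t => ?_⟩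
  · have hconvex' := convex_region hconvex s
    exact ⟨(hf.region s).contractibleSpace hconvex' (hregion s), (hf.region s).isGeodesic hconvex'⟩
  · have hRP : R ⊆ nonnegPart (P μ) := fun p hp => ⟨(hRQ hp).1.1, (hRQ hp).2⟩
    exact (isLeast_dInf_region hμ hf hRP s t).isGLB
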